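/- Call a polygonal chain $P$ in $\mathbb{R}^2$ with vertices $v_1,\dots,v_n$ *$x$-monotone* if the $x$-coordinates of $v_1,\dots,v_n$ are strictly increasing; $P$ is the union of its vertices and of the segments $v_iv_{i+1}$. Let $\mathbb{M}_P$ be the set of points of $\mathbb{R}^2$ that lie on or above $P$, that is, of the points $(x,y)$ with $y\ge y'$ for some $(x,y')\in P$. A point $g\in P$ *sees* a point $p$ if the line segment $gp$ contains no point strictly below $P$ (no point $(x,y)$ with $y<y'$ for some $(x,y')\in P$). A set of points sees $\mathbb{M}_P$ if every point of $\mathbb{M}_P$ is seen by at least one point of the set. **Theorem.** There are an absolute constant $K$, a polynomial $T$, and a deterministic algorithm on the real RAM (exact real arithmetic $+,-,\times,\div$ and comparisons at unit cost, with no rounding; natural-number indices and counters with addition, truncated subtraction and comparison) with the following property. Given the coordinates of the vertices, listed from left to right, of an $x$-monotone polygonal chain $P$ with $n$ vertices and the coordinates of guards $g_1,\dots,g_m\in P$ such that $\mathcal{G}=\{g_1,\dots,g_m\}$ sees $\mathbb{M}_P$, the algorithm halts after at most $T(n+m)$ steps and returns a subset $C\subseteq\mathcal{G}$ that also sees $\mathbb{M}_P$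 and satisfies $|C|\le K\cdot|H|$ for every subset $H\subseteq\mathcal{G}$ that sees $\mathbb{M}_P$. -/

import Mathlib

/-! ### Polygonal chains and visibility in the plane -/

namespace ChainGuard

/-- The polygonal chain with vertices `v 0, …, v (n - 1)`: the union of the vertices and of
the segments joining consecutive vertices. -/
def chain {n : ℕ} (v : Fin n → ℝ × ℝ) : Set (ℝ × ℝ) :=
  Set.range v ∪ {p | ∃ i j : Fin n, (i : ℕ) + 1 = j ∧ p ∈ segment ℝ (v i) (v j)}

/-- The chain is (strictly) `x`-monotone and its vertices are listed from left to right. -/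
def IsXMonotone {n : ℕ} (v : Fin n → ℝ × ℝ) : Prop :=
  StrictMono fun i => (v i).1

/-- The points of the plane that lie on or above the chain. -/
def onOrAbove {n : ℕ} (v : Fin n → ℝ × ℝ) : Set (ℝ × ℝ) :=
  {p | ∃ q ∈ chain v, q.1 = p.1 ∧ q.2 ≤ p.2}

/-- The points of the plane that lie strictly below the chain. -/
def strictlyBelow {n : ℕ} (v : Fin n → ℝ × ℝ) : Set (ℝ × ℝ) :=
  {p | ∃ q ∈ chain v, q.1 = p.1 ∧ p.2 < q.2}

/-- `g` sees `p`: the segment `gp` does not meet the region strictly below the chain. -/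
def Sees {n : ℕ} (v : Fin n → ℝ × ℝ) (g p : ℝ × ℝ) : Prop :=
  Disjoint (segment ℝ g p) (strictlyBelow v)

/-- The visibility polygon of `g`. -/
def vis {n : ℕ} (v : Fin n → ℝ × ℝ) (g : ℝ × ℝ) : Set (ℝ × ℝ) :=
  {p | Sees v g p}

/-- The guards with index in `H` together see every point on or above the chain. -/
def Guards {n m : ℕ} (v : Fin n → ℝ × ℝ) (g : Fin m → ℝ × ℝ) (H : Finset (Fin m)) : Prop :=
  onOrAbove v ⊆ ⋃ j ∈ H, vis v (g j)

end ChainGuard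

/-! ### A real RAM with unit-cost steps

The machine has natural-number and real variables and arrays, each named by a natural number.
A program is a fixed finite text, so it uses finitely many variables and arrays.
Natural numbers, which serve as array indices and counters, can be added, subtracted (truncated
at `0`) and compared.  Real numbers can be added, subtracted, multiplied, divided and compared
exactly; there is no rounding, and no conversion of real numbers to natural numbers. -/

namespace RealRAM

/-- The contents of the memory. -/
structure State where
  /-- natural-number variables -/
  natVar : ℕ → ℕ
  /-- real variables -/
  realVar : ℕ → ℝ
  /-- `natArr a k` is entry `k` of the natural-number array `a` -/
  natArr : ℕ → ℕ → ℕ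
  /-- `realArr a k` is entry `k` of the real array `a` -/
  realArr : ℕ → ℕ → ℝ

/-- The elementary operations.  The first argument of each is the target. -/
inductive Instr where
  /-- `x := c` -/
  | natConst (x c : ℕ)
  /-- `x := y + z` -/
  | natAdd (x y z : ℕ)
  /-- `x := max (y - z) 0` -/
  | natSub (x y z : ℕ)
  /-- `x := a[i]` -/
  | natLoad (x a i : ℕ)
  /-- `a[i] := x` -/
  | natStore (a i x : ℕ)
  /-- `x := c` -/
  | realConst (x : ℕ) (c : ℚ)
  /-- `x := y + z` -/
  | realAdd (x y z : ℕ)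
  /-- `x := y - z` -/
  | realSub (x y z : ℕ)
  /-- `x := y * z` -/
  | realMul (x y z : ℕ)
  /-- `x := y / z`, with value `0` if `z = 0` -/
  | realDiv (x y z : ℕ)
  /-- `x := a[i]`, where the index `i` is a natural-number variable -/
  | realLoad (x a i : ℕ)
  /-- `a[i] := x`, where the index `i` is a natural-number variable -/
  | realStore (a i x : ℕ)

namespace State

/-- Assign a value to a natural-number variable. -/
def setNat (s : State) (x c : ℕ) : State :=
  { s with natVar := Function.update s.natVar x c }

/-- Assign a value to a real variable. -/
def setReal (s : State) (x : ℕ) (c : ℝ) : State :=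
  { s with realVar := Function.update s.realVar x c }

/-- Assign a value to an entry of a natural-number array. -/
def setNatArr (s : State) (a k c : ℕ) : State :=
  { s with natArr := Function.update s.natArr a (Function.update (s.natArr a) k c) }

/-- Assign a value to an entry of a real array. -/
def setRealArr (s : State) (a k : ℕ) (c : ℝ) : State :=
  { s with realArr := Function.update s.realArr a (Function.update (s.realArr a) k c) }

end State

/-- The effect of an elementary operation. -/
noncomputable def Instr.run : Instr → State → State
  | .natConst x c, s => s.setNat x c
  | .natAdd x y z, s => s.setNat x (s.natVar y + s.natVar z)
  | .natSub x y z, s => s.setNat x (s.natVar y - s.natVar z)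
  | .natLoad x a i, s => s.setNat x (s.natArr a (s.natVar i))
  | .natStore a i x, s => s.setNatArr a (s.natVar i) (s.natVar x)
  | .realConst x c, s => s.setReal x (c : ℝ)
  | .realAdd x y z, s => s.setReal x (s.realVar y + s.realVar z)
  | .realSub x y z, s => s.setReal x (s.realVar y - s.realVar z)
  | .realMul x y z, s => s.setReal x (s.realVar y * s.realVar z)
  | .realDiv x y z, s => s.setReal x (s.realVar y / s.realVar z)
  | .realLoad x a i, s => s.setReal x (s.realArr a (s.natVar i))
  | .realStore a i x, s => s.setRealArr a (s.natVar i) (s.realVar x)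

/-- The comparisons that a program can branch on. -/
inductive Cond where
  | natLe (x y : ℕ)
  | natLt (x y : ℕ)
  | realLe (x y : ℕ)
  | realLt (x y : ℕ)

/-- The truth value of a comparison. -/
def Cond.Holds : Cond → State → Prop
  | .natLe x y, s => s.natVar x ≤ s.natVar y
  | .natLt x y, s => s.natVar x < s.natVar y
  | .realLe x y, s => s.realVar x ≤ s.realVar y
  | .realLt x y, s => s.realVar x < s.realVar y

/-- Programs. -/
inductive Prog where
  /-- one elementary operation -/
  | op (i : Instr)
  /-- do nothing -/
  | skip
  /-- first `P`, then `Q` -/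
  | seq (P Q : Prog)
  /-- if `c` then `P` else `Q` -/
  | branch (c : Cond) (P Q : Prog)
  /-- while `c` do `P` -/
  | loop (c : Cond) (P : Prog)

/-- `Exec P s s' t`: started in state `s`, the program `P` halts in state `s'` after exactly
`t` steps; each elementary operation and each evaluation of a comparison is one step. -/
inductive Exec : Prog → State → State → ℕ → Prop
  | op (i : Instr) (s : State) : Exec (.op i) s (i.run s) 1
  | skip (s : State) : Exec .skip s s 0
  | seq {P Q : Prog} {s₁ s₂ s₃ : State} {t u : ℕ} :
      Exec P s₁ s₂ t → Exec Q s₂ s₃ u → Exec (.seq P Q) s₁ s₃ (t + u)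
  | branch_true {c : Cond} {P Q : Prog} {s s' : State} {t : ℕ} :
      c.Holds s → Exec P s s' t → Exec (.branch c P Q) s s' (t + 1)
  | branch_false {c : Cond} {P Q : Prog} {s s' : State} {t : ℕ} :
      ¬ c.Holds s → Exec Q s s' t → Exec (.branch c P Q) s s' (t + 1)
  | loop_true {c : Cond} {P : Prog} {s₁ s₂ s₃ : State} {t u : ℕ} :
      c.Holds s₁ → Exec P s₁ s₂ t → Exec (.loop c P) s₂ s₃ u →
        Exec (.loop c P) s₁ s₃ (t + u + 1)
  | loop_false {c : Cond} {P : Prog} {s : State} :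
      ¬ c.Holds s → Exec (.loop c P) s s 1

end RealRAM

namespace ChainGuard

/-- Entry `k` of a finite list of reals, extended by `0`. -/
def extend {n : ℕ} (f : Fin n → ℝ) (k : ℕ) : ℝ :=
  if h : k < n then f ⟨k, h⟩ else 0

/-- The initial memory for a chain with `n` vertices and for `m` guards.  The first two
natural-number variables hold `n` and `m`, the first four real arrays hold the `x`- and
`y`-coordinates of the vertices and the `x`- and `y`-coordinates of the guards, and
everything else is `0`. -/
def input {n m : ℕ} (v : Fin n → ℝ × ℝ) (g : Fin m → ℝ × ℝ) : RealRAM.State where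
  natVar
    | 0 => n
    | 1 => m
    | _ => 0
  realVar _ := 0
  natArr _ _ := 0
  realArr
    | 0 => extend fun i => (v i).1
    | 1 => extend fun i => (v i).2
    | 2 => extend fun j => (g j).1
    | 3 => extend fun j => (g j).2
    | _ => fun _ => 0

/-- The set of guards returned in a final state: guard `j` is chosen if entry `j` of the
first natural-number array is `1`. -/
def output (m : ℕ) (s : RealRAM.State) : Finset (Fin m) :=
  Finset.univ.filter fun j => s.natArr 0 j = 1

end ChainGuard

/-!
Visibility of the chain from finitely many guards changes only at finitely many critical abscissas,
so it is enough to see the midpoints between them, the targets.  This is a set cover problem.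
Multiplicative weights, presented in every round with a target of least load, yield a fractional
cover whose weight is at most twice the size of any cover.  Every target receives at least a third
of its load from guards to the left of it, from guards to the right of it, or from guards above its
own abscissa.  One-sided visibility is nested: if `a < b < c < d`, and `a` sees `c` while `b` sees
`d`, then `a` sees `d`.  Hence the targets in which a greedy sweep selects a guard can be charged to
disjoint sets of guards, each of weight at least `1/3`.  A sweep therefore selects at most six times
the optimum, and three sweeps give the factor `18`.  Every step evaluates sums, products and first
indices over ranges of polynomial length, which the machine does in polynomial time.
-/

namespace RealRAM

/-! ### Running programs -/

/-- Total correctness with a time bound: started in `s`, the program `P` halts after at most `τ`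
steps in a state that satisfies `Q`. -/
def Runs (P : Prog) (s : State) (τ : ℕ) (Q : State → Prop) : Prop :=
  ∃ s' t, Exec P s s' t ∧ t ≤ τ ∧ Q s'

section Runs

variable {P P' : Prog} {c : Cond} {s : State} {τ τ' : ℕ} {Q R : State → Prop}

theorem Runs.mono (h : Runs P s τ Q) (hτ : τ ≤ τ') (hQ : ∀ s', Q s' → R s') : Runs P s τ' R :=
  let ⟨s', t, hP, ht, hs⟩ := h
  ⟨s', t, hP, ht.trans hτ, hQ s' hs⟩

theorem Runs.op {i : Instr} (h : Q (i.run s)) : Runs (.op i) s 1 Q :=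
  ⟨_, 1, .op i s, le_rfl, h⟩

theorem Runs.seq (h : Runs P s τ Q) (h' : ∀ s', Q s' → Runs P' s' τ' R) :
    Runs (.seq P P') s (τ + τ') R :=
  let ⟨s₁, _, hP, ht, hs⟩ := h
  let ⟨s₂, _, hP', ht', hs'⟩ := h' s₁ hs
  ⟨s₂, _, .seq hP hP', Nat.add_le_add ht ht', hs'⟩

theorem Runs.op_seq {i : Instr} (h : Runs P (i.run s) τ Q) : Runs (.seq (.op i) P) s (τ + 1) Q :=
  let ⟨s', t, hP, ht, hs⟩ := h
  ⟨s', 1 + t, .seq (.op i s) hP, by lia, hs⟩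

theorem Runs.branch (h : c.Holds s → Runs P s τ Q) (h' : ¬ c.Holds s → Runs P' s τ Q) :
    Runs (.branch c P P') s (τ + 1) Q := by
  by_cases hc : c.Holds s
  · obtain ⟨s', t, hP, ht, hs⟩ := h hc
    exact ⟨s', t + 1, .branch_true hc hP, by lia, hs⟩
  · obtain ⟨s', t, hP, ht, hs⟩ := h' hc
    exact ⟨s', t + 1, .branch_false hc hP, by lia, hs⟩

theorem Runs.loop {L : ℕ} (I : ℕ → State → Prop)
    (hc : ∀ k s, I k s → (c.Holds s ↔ k < L))
    (hP : ∀ k < L, ∀ s, I k s → Runs P s τ (I (k + 1))) (h0 : I 0 s) :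
    Runs (.loop c P) s (L * (τ + 1) + 1) (I L) := by
  suffices ∀ r k s, k + r = L → I k s → Runs (.loop c P) s (r * (τ + 1) + 1) (I L) from
    this L 0 s (Nat.zero_add L) h0
  intro r
  induction r with
  | zero =>
    rintro k s rfl hs
    exact ⟨s, 1, .loop_false fun h => Nat.lt_irrefl _ ((hc _ s hs).1 h), by lia, hs⟩
  | succ r ih =>
    intro k s hk hs
    obtain ⟨s₁, t₁, h₁, ht₁, hs₁⟩ := hP k (by lia) s hs
    obtain ⟨s₂, t₂, h₂, ht₂, hs₂⟩ := ih (k + 1) s₁ (by lia) hs₁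
    exact ⟨s₂, t₁ + t₂ + 1, .loop_true ((hc k s hs).2 (by lia)) h₁ h₂, by lia, hs₂⟩

end Runs

/-- The states `s` and `s'` agree on all real arrays, and on the variables and the natural-number
arrays below `d`. -/
structure Agree (d : ℕ) (s s' : State) : Prop where
  natVar : ∀ x < d, s'.natVar x = s.natVar x
  realVar : ∀ x < d, s'.realVar x = s.realVar x
  natArr : ∀ a < d, s'.natArr a = s.natArr a
  realArr : s'.realArr = s.realArr

namespace Agree

variable {d d' x : ℕ} {s s' s'' : State}

theorem refl (d : ℕ) (s : State) : Agree d s s :=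
  ⟨fun _ _ => rfl, fun _ _ => rfl, fun _ _ => rfl, rfl⟩

theorem trans (h : Agree d s s') (h' : Agree d s' s'') : Agree d s s'' where
  natVar x hx := (h'.natVar x hx).trans (h.natVar x hx)
  realVar x hx := (h'.realVar x hx).trans (h.realVar x hx)
  natArr a ha := (h'.natArr a ha).trans (h.natArr a ha)
  realArr := h'.realArr.trans h.realArr

theorem mono (h : Agree d s s') (hd : d' ≤ d) : Agree d' s s' where
  natVar x hx := h.natVar x (hx.trans_le hd)
  realVar x hx := h.realVar x (hx.trans_le hd)
  natArr a ha := h.natArr a (ha.trans_le hd)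
  realArr := h.realArr

theorem setNat (h : Agree d s s') (hx : d ≤ x) (c : ℕ) : Agree d s (s'.setNat x c) :=
  ⟨fun y hy => (Function.update_of_ne (by lia) _ _).trans (h.natVar y hy), h.realVar, h.natArr,
    h.realArr⟩

theorem setReal (h : Agree d s s') (hx : d ≤ x) (c : ℝ) : Agree d s (s'.setReal x c) :=
  ⟨h.natVar, fun y hy => (Function.update_of_ne (by lia) _ _).trans (h.realVar y hy), h.natArr,
    h.realArr⟩

theorem setNatArr (h : Agree d s s') (hx : d ≤ x) (k c : ℕ) : Agree d s (s'.setNatArr x k c) :=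
  ⟨h.natVar, h.realVar,
    fun a ha => (Function.update_of_ne (by lia) _ _).trans (h.natArr a ha), h.realArr⟩

end Agree

@[simp] theorem State.natVar_setNat_self (s : State) (x c : ℕ) : (s.setNat x c).natVar x = c :=
  Function.update_self ..

theorem State.natVar_setNat_of_ne {x y : ℕ} (h : y ≠ x) (s : State) (c : ℕ) :
    (s.setNat x c).natVar y = s.natVar y :=
  Function.update_of_ne h ..

theorem State.setNat_natVar (s : State) (x : ℕ) : s.setNat x (s.natVar x) = s := by
  simp [State.setNat]

/-! ### Registers -/

/-- A type whose values are held by variables of the machine. -/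
class Register (V : Type) where
  /-- the value of a variable -/
  get : State → ℕ → V
  /-- assignment to a variable -/
  set : State → ℕ → V → State
  /-- `copy x y` assigns the value of variable `y` to variable `x` -/
  copy : ℕ → ℕ → Prog
  get_set_self : ∀ s x c, get (set s x c) x = c
  natVar_set_of_ne : ∀ {x y}, y ≠ x → ∀ s c, (set s x c).natVar y = s.natVar y
  get_setNat_of_ne : ∀ {x y}, y ≠ x → ∀ s c, get (s.setNat x c) y = get s y
  get_eq_of_agree : ∀ {d s s' x}, Agree d s s' → x < d → get s' x = get s x
  agree_set : ∀ {d s s' x}, Agree d s s' → d ≤ x → ∀ c, Agree d s (set s' x c)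
  runs_copy : ∀ {x y}, y ≠ x → ∀ s, Runs (copy x y) s 2 (· = set s x (get s y))

noncomputable instance : Register ℕ where
  get := State.natVar
  set := State.setNat
  copy x y := .seq (.op (.natConst x 0)) (.op (.natAdd x y x))
  get_set_self := State.natVar_setNat_self
  natVar_set_of_ne := State.natVar_setNat_of_ne
  get_setNat_of_ne := State.natVar_setNat_of_ne
  get_eq_of_agree h := h.natVar _
  agree_set := Agree.setNat
  runs_copy h s := ⟨_, 2, .seq (.op _ _) (.op _ _), le_rfl, by
    simp [Instr.run, State.setNat, Function.update_of_ne h]⟩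

noncomputable instance : Register ℝ where
  get := State.realVar
  set := State.setReal
  copy x y := .seq (.op (.realConst x 0)) (.op (.realAdd x y x))
  get_set_self _ _ _ := Function.update_self ..
  natVar_set_of_ne _ _ _ := rfl
  get_setNat_of_ne _ _ _ := rfl
  get_eq_of_agree h := h.realVar _
  agree_set := Agree.setReal
  runs_copy h s := ⟨_, 2, .seq (.op _ _) (.op _ _), le_rfl, by
    simp [Instr.run, State.setReal, Function.update_of_ne h]⟩

@[simp] theorem get_nat (s : State) (x : ℕ) : Register.get s x = s.natVar x := rfl

@[simp] theorem set_nat (s : State) (x c : ℕ) : Register.set s x c = s.setNat x c := rfl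

@[simp] theorem get_real (s : State) (x : ℕ) : Register.get s x = s.realVar x := rfl

theorem Runs.copy_seq {V : Type} [Register V] {x y τ : ℕ} {P : Prog} {s : State}
    {Q : State → Prop} (hyx : y ≠ x)
    (h : Runs P (Register.set s x (Register.get s y : V)) τ Q) :
    Runs (.seq (Register.copy V x y) P) s (τ + 2) Q :=
  ((Register.runs_copy hyx s).seq fun _ hs => hs ▸ h).mono (Nat.add_comm _ _).le fun _ => id

/-- The value `c` is available by one instruction. -/
def IsConst {V : Type} [Register V] (c : V) : Prop :=
  ∃ I : ℕ → Instr, ∀ x s, (I x).run s = Register.set s x c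

/-- The operation `f` is available as one instruction. -/
def IsOp {V : Type} [Register V] (f : V → V → V) : Prop :=
  ∃ I : ℕ → ℕ → ℕ → Instr, ∀ x y z s,
    (I x y z).run s = Register.set s x (f (Register.get s y) (Register.get s z))

/-- The relation `r` is available as one comparison. -/
def IsTest {V : Type} [Register V] (r : V → V → Prop) : Prop :=
  ∃ c : ℕ → ℕ → Cond, ∀ x y s, (c x y).Holds s ↔ r (Register.get s x) (Register.get s y)

/-! ### Computability in polynomial time -/

/-- A type of data of which an element can be kept in the variables and arrays below `width`.
Computations that leave those alone leave the data intact. -/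
class Layout (α : Type) where
  /-- the number of variables and arrays that are reserved for the data -/
  width : ℕ
  width_pos : 0 < width
  /-- the size in terms of which running times are measured -/
  size : α → ℕ
  /-- `Holds a s` if `a` is kept in `s` -/
  Holds : α → State → Prop
  holds_of_agree : ∀ {a s s'}, Agree width s s' → Holds a s → Holds a s'
  /-- array `0` is reserved for the output -/
  holds_setNatArr_zero : ∀ {a s}, Holds a s → ∀ k c, Holds a (s.setNatArr 0 k c)

/-- A type of data of which an element can be kept in the natural-number variable and the
natural-number array with a given number. -/
class Slot (β : Type) where
  /-- the size in terms of which running times are measured -/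
  size : β → ℕ
  /-- `Stores b k s` if `b` is kept in the variable and the array number `k` -/
  Stores : β → ℕ → State → Prop
  stores_congr : ∀ {b k s s'}, s'.natVar k = s.natVar k → s'.natArr k = s.natArr k →
    Stores b k s → Stores b k s'

instance : Slot ℕ where
  size i := i
  Stores i k s := s.natVar k = i
  stores_congr h _ h' := h.trans h'

/-- The variable holds the length and the array holds the entries. -/
instance : Slot (List ℕ) where
  size l := l.length + l.sum
  Stores l k s := s.natVar k = l.length ∧ ∀ r < l.length, s.natArr k r = l.getD r 0
  stores_congr h h' h'' := ⟨h.trans h''.1, fun r hr => h' ▸ h''.2 r hr⟩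

instance {α β : Type} [Layout α] [Slot β] : Layout (α × β) where
  width := Layout.width α + 1
  width_pos := Nat.succ_pos _
  size p := Layout.size p.1 + Slot.size p.2
  Holds p s := Layout.Holds p.1 s ∧ Slot.Stores p.2 (Layout.width α) s
  holds_of_agree h h' := ⟨Layout.holds_of_agree (h.mono (Nat.le_succ _)) h'.1,
    Slot.stores_congr (h.natVar _ (Nat.lt_succ_self _))
      (h.natArr _ (Nat.lt_succ_self _)) h'.2⟩
  holds_setNatArr_zero {_ s} h k c := ⟨Layout.holds_setNatArr_zero h.1 k c,
    Slot.stores_congr (s := s) rfl (Function.update_of_ne Layout.width_pos.ne' _ _) h.2⟩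

/-- `f` is bounded by a polynomial in the size of its argument. -/
def PolyBounded {α : Type} [Layout α] (f : α → ℕ) : Prop :=
  ∃ T : Polynomial ℕ, ∀ a, f a ≤ T.eval (Layout.size a)

section PolyBounded

variable {α β : Type} [Layout α] [Slot β] {f g : α → ℕ}

theorem PolyBounded.mono (h : PolyBounded g) (hf : ∀ a, f a ≤ g a) : PolyBounded f :=
  h.imp fun _ hT a => (hf a).trans (hT a)

theorem polyBounded_const (c : ℕ) : PolyBounded fun _ : α => c :=
  ⟨.C c, fun _ => by simp⟩

theorem PolyBounded.add (hf : PolyBounded f) (hg : PolyBounded g) :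
    PolyBounded fun a => f a + g a :=
  let ⟨T, hT⟩ := hf
  let ⟨U, hU⟩ := hg
  ⟨T + U, fun a => by simpa using Nat.add_le_add (hT a) (hU a)⟩

theorem PolyBounded.mul (hf : PolyBounded f) (hg : PolyBounded g) :
    PolyBounded fun a => f a * g a :=
  let ⟨T, hT⟩ := hf
  let ⟨U, hU⟩ := hg
  ⟨T * U, fun a => by simpa using Nat.mul_le_mul (hT a) (hU a)⟩

theorem eval_mono (T : Polynomial ℕ) : Monotone fun k => T.eval k := by
  intro k l hkl
  simp only [Polynomial.eval_eq_sum]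
  exact Finset.sum_le_sum fun i _ => Nat.mul_le_mul_left _ (Nat.pow_le_pow_left hkl i)

theorem PolyBounded.exists_uniform {f : α × β → ℕ} (hf : PolyBounded f) (hg : PolyBounded g) :
    ∃ τ : α → ℕ, PolyBounded τ ∧ ∀ a b, Slot.size b ≤ g a → f (a, b) ≤ τ a := by
  obtain ⟨T, hT⟩ := hf
  obtain ⟨U, hU⟩ := hg
  refine ⟨fun a => T.eval (Layout.size a + U.eval (Layout.size a)), ⟨T.comp (.X + U), fun a => ?_⟩,
    fun a b hb => (hT _).trans (eval_mono T (Nat.add_le_add_left (hb.trans (hU a)) _))⟩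
  simp

theorem PolyBounded.weaken (hf : PolyBounded f) : PolyBounded fun p : α × β => f p.1 :=
  let ⟨T, hT⟩ := hf
  ⟨T, fun _ => (hT _).trans (eval_mono T (Nat.le_add_right _ _))⟩

theorem polyBounded_slotSize : PolyBounded fun p : α × β => Slot.size p.2 :=
  ⟨.X, fun p => by simp [Layout.size]⟩

end PolyBounded

/-- `f` can be computed in polynomial time, into the variable number `d`, for every choice of `d`
above the variables that hold the data, without changing anything below `d`. -/
def Computes {α V : Type} [Layout α] [Register V] (f : α → V) : Prop :=
  ∀ d, Layout.width α ≤ d → ∃ (P : Prog) (τ : α → ℕ), PolyBounded τ ∧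
    ∀ a s, Layout.Holds a s → Runs P s (τ a) fun s' => Agree d s s' ∧ Register.get s' d = f a

open Classical in
/-- `p` can be decided in polynomial time. -/
def Decides {α : Type} [Layout α] (p : α → Prop) : Prop :=
  Computes fun a => if p a then 1 else 0

/-- `f` can be computed in polynomial time and has polynomially bounded values, as is required of
limits of loops. -/
structure IsLimit {α : Type} [Layout α] (f : α → ℕ) : Prop where
  computes : Computes f
  polyBounded : PolyBounded f

section Computes

variable {α β V : Type} [Layout α] [Slot β] [Register V] {f g : α → V} {p q : α → Prop}

theorem Computes.weaken (hf : Computes f) : Computes fun p : α × β => f p.1 := by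
  intro d hd
  obtain ⟨P, τ, hτ, hP⟩ := hf d ((Nat.le_succ _).trans hd)
  exact ⟨P, _, hτ.weaken, fun a s hs => hP a.1 s hs.1⟩

theorem IsConst.computes {c : V} (hc : IsConst c) : Computes fun _ : α => c := by
  obtain ⟨I, hI⟩ := hc
  refine fun d _ => ⟨.op (I d), _, polyBounded_const 1, fun _ s _ => Runs.op ?_⟩
  rw [hI]
  exact ⟨Register.agree_set (.refl d s) le_rfl _, Register.get_set_self ..⟩

theorem Computes.exists_pair (hf : Computes f) (hg : Computes g) {d : ℕ}
    (hd : Layout.width α ≤ d) :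
    ∃ (P : Prog) (τ : α → ℕ), PolyBounded τ ∧ ∀ a s, Layout.Holds a s → Runs P s (τ a) fun s' =>
      Agree d s s' ∧ Register.get s' d = f a ∧ Register.get s' (d + 1) = g a := by
  obtain ⟨P, τ, hτ, hP⟩ := hf d hd
  obtain ⟨P', τ', hτ', hP'⟩ := hg (d + 1) (by lia)
  refine ⟨.seq P P', _, hτ.add hτ', fun a s hs => (hP a s hs).seq fun s₁ ⟨hs₁, h₁⟩ => ?_⟩
  refine (hP' a s₁ (Layout.holds_of_agree (hs₁.mono hd) hs)).mono le_rfl fun s₂ ⟨hs₂, h₂⟩ => ?_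
  exact ⟨hs₁.trans (hs₂.mono (by lia)), (Register.get_eq_of_agree hs₂ (by lia)).trans h₁, h₂⟩

theorem IsOp.computes {op : V → V → V} (hop : IsOp op) (hf : Computes f) (hg : Computes g) :
    Computes fun a => op (f a) (g a) := by
  intro d hd
  obtain ⟨I, hI⟩ := hop
  obtain ⟨P, τ, hτ, hP⟩ := hf.exists_pair hg hd
  refine ⟨.seq P (.op (I d d (d + 1))), _, hτ.add (polyBounded_const 1), fun a s hs =>
    (hP a s hs).seq fun s' ⟨hs', h₁, h₂⟩ => Runs.op ?_⟩
  rw [hI, h₁, h₂]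
  exact ⟨Register.agree_set hs' le_rfl _, Register.get_set_self ..⟩

theorem IsTest.decides {r : V → V → Prop} (hr : IsTest r) (hf : Computes f) (hg : Computes g) :
    Decides fun a => r (f a) (g a) := by
  intro d hd
  obtain ⟨c, hc⟩ := hr
  obtain ⟨P, τ, hτ, hP⟩ := hf.exists_pair hg hd
  refine ⟨.seq P (.branch (c d (d + 1)) (.op (.natConst d 1)) (.op (.natConst d 0))), _,
    hτ.add (polyBounded_const 2), fun a s hs => (hP a s hs).seq fun s' ⟨hs', h₁, h₂⟩ => ?_⟩
  have hiff : (c d (d + 1)).Holds s' ↔ r (f a) (g a) := by rw [hc, h₁, h₂]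
  refine Runs.branch (fun h => Runs.op ⟨hs'.setNat le_rfl _, ?_⟩)
    fun h => Runs.op ⟨hs'.setNat le_rfl _, ?_⟩ <;> simp [Instr.run, ← hiff, h]

open Classical in
theorem Decides.ite (hp : Decides p) (hf : Computes f) (hg : Computes g) :
    Computes fun a => if p a then f a else g a := by
  intro d hd
  obtain ⟨C, σ, hσ, hC⟩ := hp.exists_pair (IsConst.computes ⟨(.natConst · 0), fun _ _ => rfl⟩) hd
  obtain ⟨P, τ, hτ, hP⟩ := hf d hd
  obtain ⟨P', τ', hτ', hP'⟩ := hg d hd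
  refine ⟨.seq C (.branch (.natLt (d + 1) d) P P'), _,
    hσ.add ((hτ.add hτ').add (polyBounded_const 1)), fun a s hs =>
    (hC a s hs).seq fun s₁ ⟨hs₁, h₁, h₂⟩ => ?_⟩
  have hHolds := Layout.holds_of_agree (hs₁.mono hd) hs
  have hiff : (Cond.natLt (d + 1) d).Holds s₁ ↔ p a := by
    simp only [get_nat] at h₁ h₂
    by_cases h : p a <;> simp [Cond.Holds, h₁, h₂, h]
  refine Runs.branch (fun h => (hP a s₁ hHolds).mono (by lia) fun s₂ ⟨hs₂, h⟩ => ?_)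
    fun h => (hP' a s₁ hHolds).mono (by lia) fun s₂ ⟨hs₂, h⟩ => ?_
  all_goals rw [hiff] at *; simp_all [hs₁.trans hs₂]

end Computes

/-! ### Loops -/

/-- For `w` from `0` to the value of variable `x` minus `1` do `B`; variable `x + 1` holds the
increment. -/
def Prog.forLoop (w x : ℕ) (B : Prog) : Prog :=
  .seq (.op (.natConst (x + 1) 1)) (.seq (.op (.natConst w 0))
    (.loop (.natLt w x) (.seq B (.op (.natAdd w w (x + 1))))))

theorem Runs.forLoop {w x L τ : ℕ} {B : Prog} {s : State} (hwx : w < x) (I : ℕ → State → Prop)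
    (hB : ∀ k < L, ∀ s, s.natVar w = k → I k s → Runs B s τ fun s' =>
      (∀ y < x + 2, s'.natVar y = s.natVar y) ∧ I (k + 1) (s'.setNat w (k + 1)))
    (hx : s.natVar x = L) (h0 : I 0 ((s.setNat (x + 1) 1).setNat w 0)) :
    Runs (.forLoop w x B) s (L * (τ + 2) + 3)
      fun s' => s'.natVar w = L ∧ s'.natVar x = L ∧ I L s' := by
  let J (k : ℕ) (s : State) : Prop :=
    s.natVar w = k ∧ s.natVar x = L ∧ s.natVar (x + 1) = 1 ∧ I k s
  have hJ0 : J 0 ((s.setNat (x + 1) 1).setNat w 0) := by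
    refine ⟨by simp, ?_, ?_, h0⟩ <;>
      simp [State.natVar_setNat_of_ne, hwx.ne', (hwx.trans (Nat.lt_succ_self x)).ne', hx]
  have hstep : ∀ k < L, ∀ s, J k s → Runs (.seq B (.op (.natAdd w w (x + 1)))) s (τ + 1)
      (J (k + 1)) := by
    rintro k hk s ⟨h₁, h₂, h₃, hI⟩
    refine (hB k hk s h₁ hI).seq fun s' ⟨hs', hI'⟩ => .op ?_
    have hval : s'.natVar w + s'.natVar (x + 1) = k + 1 := by
      rw [hs' w (by lia), hs' (x + 1) (by lia), h₁, h₃]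
    simp only [Instr.run, hval]
    refine ⟨by simp, ?_, ?_, hI'⟩ <;> rw [State.natVar_setNat_of_ne (by lia), hs' _ (by lia)]
    exacts [h₂, h₃]
  have hloop := Runs.loop J (c := .natLt w x) (fun k s hs => by simp [Cond.Holds, hs.1, hs.2.1])
    hstep hJ0
  exact (Runs.op_seq (.op_seq hloop)).mono (by lia) fun s' hs' => ⟨hs'.1, hs'.2.1, hs'.2.2.2⟩

section Loops

variable {α V : Type} [Layout α] [Register V]

theorem Agree.of_setNat {d w c : ℕ} {s s' : State} (h : Agree d s (s'.setNat w c)) (hw : w ≤ d) :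
    Agree w s s' where
  natVar x hx := (State.natVar_setNat_of_ne hx.ne s' c).symm.trans (h.natVar x (hx.trans_le hw))
  realVar x hx := h.realVar x (hx.trans_le hw)
  natArr a ha := h.natArr a (ha.trans_le hw)
  realArr := h.realArr

theorem Agree.setNat_setNat {d w c k : ℕ} {s s₁ s₂ : State} (h : Agree d s (s₁.setNat w c))
    (h' : Agree d s₁ s₂) : Agree d s ((s₂.setNat w k).setNat w c) := by
  refine ⟨fun y hy => ?_, fun y hy => (h'.realVar y hy).trans (h.realVar y hy),
    fun a ha => (h'.natArr a ha).trans (h.natArr a ha), h'.realArr.trans h.realArr⟩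
  rw [← h.natVar y hy]
  by_cases hyw : y = w
  · simp [hyw]
  · simp [State.natVar_setNat_of_ne hyw, h'.natVar y hy]

/-- The invariant of a loop that computes `F 0, F 1, …` one after the other.  Below `d`, only the
loop index `w` may differ from the state `s` before the loop; its old value is kept in `d + 1`, and
`F k` is in `d + 4`. -/
structure RecursionInv (w d : ℕ) (s : State) (F : ℕ → V) (k : ℕ) (s' : State) : Prop where
  agree : Agree d s (s'.setNat w (s.natVar w))
  saved : s'.natVar (d + 1) = s.natVar w
  value : Register.get s' (d + 4) = F k

theorem RecursionInv.init {w d : ℕ} {s s' : State} {F : ℕ → V} (hwd : w ≤ d)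
    (h : Agree (d + 2) (s.setNat (d + 1) (s.natVar w)) s') :
    RecursionInv w d s F 0 (((Register.set s' (d + 4) (F 0)).setNat (d + 3) 1).setNat w 0) := by
  have hs : Agree d s (s.setNat (d + 1) (s.natVar w)) := (Agree.refl _ s).setNat (by lia) _
  have hs' : Agree (d + 2) s' ((Register.set s' (d + 4) (F 0)).setNat (d + 3) 1) :=
    (Register.agree_set (.refl _ _) (by lia) _).setNat (by lia) _
  refine ⟨Agree.setNat_setNat (by rw [State.setNat_natVar]; exact .refl d s)
    (hs.trans ((h.trans hs').mono (by lia))), ?_, ?_⟩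
  · rw [State.natVar_setNat_of_ne (by lia), hs'.natVar _ (by lia), h.natVar _ (by lia)]
    exact State.natVar_setNat_self ..
  · rw [Register.get_setNat_of_ne (by lia), Register.get_setNat_of_ne (by lia),
      Register.get_set_self]

theorem RecursionInv.step {w d k : ℕ} {s s₁ s₂ : State} {F : ℕ → V} (hwd : w ≤ d)
    (h : RecursionInv w d s F k s₁)
    (h' : Agree (d + 4) s₁ (Register.set s₂ (d + 4) (F (k + 1)))) :
    RecursionInv w d s F (k + 1) ((Register.set s₂ (d + 4) (F (k + 1))).setNat w (k + 1)) := by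
  refine ⟨h.agree.setNat_setNat (h'.mono (by lia)), ?_, ?_⟩
  · rw [State.natVar_setNat_of_ne (by lia), h'.natVar _ (by lia), h.saved]
  · rw [Register.get_setNat_of_ne (by lia), Register.get_set_self]

theorem Computes.recursion {op : V → V → V} (hop : IsOp op) {c : V} (hc : IsConst c)
    {f : α × ℕ → V} (hf : Computes f) {ℓ : α → ℕ} (hℓ : IsLimit ℓ) (F : α → ℕ → V)
    (hF₀ : ∀ a, F a 0 = c) (hF : ∀ a k, F a (k + 1) = op (F a k) (f (a, k))) :
    Computes fun a => F a (ℓ a) := by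
  intro d hd
  obtain ⟨I, hI⟩ := hop
  obtain ⟨C, hC⟩ := hc
  obtain ⟨P, σ, hσ, hP⟩ := hℓ.computes (d + 2) (by lia)
  obtain ⟨B, υ, hυ, hB⟩ := hf (d + 5) (Nat.succ_le_succ (by lia))
  obtain ⟨τ, hτ, hυτ⟩ := hυ.exists_uniform hℓ.polyBounded
  set w := Layout.width α
  refine ⟨.seq (Register.copy ℕ (d + 1) w) (.seq P (.seq (.op (C (d + 4)))
      (.seq (.forLoop w (d + 2) (.seq B (.op (I (d + 4) (d + 4) (d + 5)))))
        (.seq (Register.copy ℕ w (d + 1)) (Register.copy V d (d + 4)))))),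
    fun a => σ a + ((ℓ a * (τ a + 1 + 2) + 3 + 4) + 1) + 2, ?_, fun a s hs => .copy_seq (by lia) ?_⟩
  · exact (hσ.add ((hℓ.polyBounded.mul (hτ.add (polyBounded_const 3))).add
      (polyBounded_const 10))).mono fun a => by lia
  have hs₁ : Agree (d + 1) s (s.setNat (d + 1) (s.natVar w)) := (Agree.refl _ s).setNat le_rfl _
  refine (hP a _ (Layout.holds_of_agree (hs₁.mono (by lia)) hs)).seq fun s₂ ⟨hs₂, h₂⟩ => .op_seq ?_
  rw [hC, ← hF₀ a]
  refine (Runs.forLoop (by lia) (RecursionInv w d s (F a)) (fun k hk s' hw hs' => ?_)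
    ((Register.natVar_set_of_ne (by lia) _ _).trans h₂) (.init hd hs₂)).seq (τ' := 4)
      fun s' hs' => ?_
  · refine ((hB (a, k) s' ⟨Layout.holds_of_agree (hs'.agree.of_setNat hd) hs, hw⟩).mono
      (hυτ a k hk.le) fun _ => id).seq fun s₁ ⟨hs₁, hval⟩ => .op ?_
    rw [hI, Register.get_eq_of_agree hs₁ (by lia), hs'.value, hval, ← hF]
    have hs'' : Agree (d + 4) s' (Register.set s₁ (d + 4) (F a (k + 1))) :=
      Register.agree_set (hs₁.mono (by lia)) le_rfl _
    exact ⟨hs''.natVar, hs'.step hd hs''⟩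
  · refine (Runs.copy_seq (by lia) (Register.runs_copy (by lia) _)).mono le_rfl ?_
    rintro _ rfl
    rw [get_nat, set_nat, hs'.2.2.saved]
    refine ⟨Register.agree_set hs'.2.2.agree le_rfl _, ?_⟩
    rw [Register.get_set_self, Register.get_setNat_of_ne (by lia), hs'.2.2.value]

end Loops

/-! ### Lists -/

/-- The list of length `k` each of whose entries is `F` of the list of the entries before it. -/
def history (F : List ℕ → ℕ) : ℕ → List ℕ
  | 0 => []
  | k + 1 => history F k ++ [F (history F k)]

section Lists

variable {α : Type} [Layout α]

@[simp] theorem length_history (F : List ℕ → ℕ) (k : ℕ) : (history F k).length = k := by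
  induction k with
  | zero => rfl
  | succ k ih => simp [history, ih]

theorem getD_history (F : List ℕ → ℕ) {r k : ℕ} (h : r < k) :
    (history F k).getD r 0 = F (history F r) := by
  induction k with
  | zero => lia
  | succ k ih =>
    rcases Nat.lt_succ_iff_lt_or_eq.1 h with hr | rfl
    · rw [history, List.getD_append _ _ _ _ (by simpa using hr), ih hr]
    · simp [history]

/-- The rule `G`, which determines entry `k` of a sequence from the entries before it, applied to
the list of these entries. -/
def onList (G : (ℕ → ℕ) → ℕ → ℕ) (l : List ℕ) : ℕ :=
  G (fun r => l.getD r 0) l.length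

theorem getD_history_onList {G : (ℕ → ℕ) → ℕ → ℕ}
    (hG : ∀ {q q' : ℕ → ℕ} {k}, (∀ r < k, q r = q' r) → G q k = G q' k) {k ℓ : ℕ} (hk : k < ℓ) :
    (history (onList G) ℓ).getD k 0 = G (fun r => (history (onList G) ℓ).getD r 0) k := by
  rw [getD_history _ hk, onList, length_history]
  exact hG fun r hr => (getD_history _ hr).trans (getD_history _ (hr.trans hk)).symm

theorem size_history_le {F : List ℕ → ℕ} {B : ℕ} (h : ∀ l, F l ≤ B) (k : ℕ) :
    Slot.size (history F k) ≤ k + k * B := by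
  suffices (history F k).sum ≤ k * B by simpa [Slot.size] using this
  induction k with
  | zero => simp [history]
  | succ k ih =>
    have := h (history F k)
    simp only [history, List.sum_append, List.sum_singleton]
    lia

/-- The datum `g a` has polynomial size, and it can be put into the slot after those of `a` in
polynomial time. -/
def Constructs {α β : Type} [Layout α] [Slot β] (g : α → β) : Prop :=
  PolyBounded (fun a => Slot.size (g a)) ∧ ∃ (P : Prog) (τ : α → ℕ), PolyBounded τ ∧
    ∀ a s, Layout.Holds a s → Runs P s (τ a) (Layout.Holds (a, g a))

theorem stores_append {l : List ℕ} {k : ℕ} {s : State} (h : Slot.Stores l k s) (c : ℕ) :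
    Slot.Stores (l ++ [c]) k ((s.setNatArr k l.length c).setNat k (l.length + 1)) := by
  refine ⟨by simp, fun r hr => ?_⟩
  rw [List.length_append, List.length_singleton, Nat.lt_succ_iff_lt_or_eq] at hr
  rcases hr with hr | rfl
  · rw [List.getD_append _ _ _ _ hr, ← h.2 r hr]
    simp [State.setNat, State.setNatArr, hr.ne]
  · simp [State.setNat, State.setNatArr]

theorem Computes.constructs_history {F : α × List ℕ → ℕ} (hF : Computes F) {ℓ b : α → ℕ}
    (hℓ : IsLimit ℓ) (hb : PolyBounded b) (hFb : ∀ a l, F (a, l) ≤ b a) :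
    Constructs fun a => history (fun l => F (a, l)) (ℓ a) := by
  have hsize := hℓ.polyBounded.add (hℓ.polyBounded.mul hb)
  obtain ⟨P, σ, hσ, hP⟩ := hℓ.computes (Layout.width α + 1) (by lia)
  obtain ⟨B, υ, hυ, hB⟩ := hF (Layout.width α + 3) (Nat.succ_le_succ (by lia))
  obtain ⟨τ, hτ, hυτ⟩ := hυ.exists_uniform hsize
  set w := Layout.width α
  refine ⟨hsize.mono fun a => size_history_le (hFb a) _,
    .seq P (.forLoop w (w + 1) (.seq B (.op (.natStore w w (w + 3))))),
    _, hσ.add ((hℓ.polyBounded.mul (hτ.add (polyBounded_const 3))).add (polyBounded_const 3)),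
    fun a s hs => (hP a s hs).seq fun s₁ ⟨hs₁, h₁⟩ => ?_⟩
  set H := history fun l => F (a, l) with hH
  refine (Runs.forLoop (by lia) (fun k s' => Agree w s s' ∧ Slot.Stores (H k) w s')
    (fun k hk s' hk' ⟨hA, hS⟩ => ?_) h₁ ⟨?_, by simp [hH, history, Slot.Stores]⟩).mono le_rfl
    fun s' hs' => ⟨Layout.holds_of_agree hs'.2.2.1 hs, hs'.2.2.2⟩
  · have hsize : Slot.size (H k) ≤ ℓ a + ℓ a * b a :=
      (size_history_le (hFb a) k).trans (Nat.add_le_add hk.le (Nat.mul_le_mul_right _ hk.le))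
    refine ((hB _ s' ⟨Layout.holds_of_agree hA hs, hS⟩).mono (hυτ a _ hsize) fun _ => id).seq
      fun s₂ ⟨hs₂, hval⟩ => .op
        ⟨hs₂.natVar, ((hA.trans (hs₂.mono (by lia))).setNatArr le_rfl _ _).setNat le_rfl _, ?_⟩
    have hlen : s₂.natVar w = (H k).length := by rw [hs₂.natVar w (by lia), hk', length_history]
    have := stores_append (Slot.stores_congr (hs₂.natVar w (by lia))
      (hs₂.natArr w (by lia)) hS) (F (a, H k))
    rw [length_history] at this
    rw [get_nat] at hval
    simpa only [Instr.run, hlen, length_history, hval, hH, history] using this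
  · exact ((hs₁.mono (by lia)).setNat (by lia) _).setNat le_rfl _

/-- The numbers `j < ℓ a` with `p (a, j)` can be marked by `1` in the natural-number array `0` in
polynomial time. -/
def Marks (p : α × ℕ → Prop) (ℓ : α → ℕ) : Prop :=
  ∃ (P : Prog) (τ : α → ℕ), PolyBounded τ ∧ ∀ a s, Layout.Holds a s →
    Runs P s (τ a) fun s' => ∀ j < ℓ a, s'.natArr 0 j = 1 ↔ p (a, j)

theorem Decides.marks {p : α × ℕ → Prop} (hp : Decides p) {ℓ : α → ℕ} (hℓ : IsLimit ℓ) :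
    Marks p ℓ := by
  obtain ⟨P, σ, hσ, hP⟩ := hℓ.computes (Layout.width α + 1) (by lia)
  obtain ⟨B, υ, hυ, hB⟩ := hp (Layout.width α + 3) (Nat.succ_le_succ (by lia))
  obtain ⟨τ, hτ, hυτ⟩ := hυ.exists_uniform hℓ.polyBounded
  set w := Layout.width α
  refine ⟨.seq P (.forLoop w (w + 1) (.seq B (.op (.natStore 0 w (w + 3))))),
    _, hσ.add ((hℓ.polyBounded.mul (hτ.add (polyBounded_const 3))).add (polyBounded_const 3)),
    fun a s hs => (hP a s hs).seq fun s₁ ⟨hs₁, h₁⟩ => ?_⟩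
  refine (Runs.forLoop (by lia)
    (fun k s' => Layout.Holds a s' ∧ ∀ j < k, s'.natArr 0 j = 1 ↔ p (a, j))
    (fun k hk s' hk' ⟨hs', hmarks⟩ => ?_) h₁ ⟨Layout.holds_of_agree ?_ hs, by simp⟩).mono le_rfl
    fun s' hs' => hs'.2.2.2
  · refine ((hB (a, k) s' ⟨hs', hk'⟩).mono (hυτ a _ hk.le) fun _ => id).seq
      fun s₂ ⟨hs₂, hval⟩ => .op ⟨hs₂.natVar,
        Layout.holds_of_agree ((Agree.refl _ _).setNat le_rfl _) (Layout.holds_setNatArr_zero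
          (Layout.holds_of_agree (hs₂.mono (by lia)) hs') _ _), ?_⟩
    intro j hj
    rw [get_nat] at hval
    simp only [Instr.run, State.setNat, State.setNatArr, Function.update_self, hval,
      hs₂.natVar w (by lia), hk']
    rcases Nat.lt_succ_iff_lt_or_eq.1 hj with hj | rfl
    · rw [Function.update_of_ne hj.ne, hs₂.natArr 0 (by lia), hmarks j hj]
    · simp
  · exact ((hs₁.mono (by lia)).setNat (by lia) _).setNat le_rfl _

theorem Constructs.marks {β : Type} [Slot β] {g : α → β} (hg : Constructs g)
    {p : (α × β) × ℕ → Prop} {ℓ : α × β → ℕ} (hp : Marks p ℓ) :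
    Marks (fun x : α × ℕ => p ((x.1, g x.1), x.2)) fun a => ℓ (a, g a) := by
  obtain ⟨hsize, P, τ, hτ, hP⟩ := hg
  obtain ⟨P', υ, hυ, hP'⟩ := hp
  obtain ⟨τ', hτ', hυτ'⟩ := hυ.exists_uniform hsize
  exact ⟨.seq P P', _, hτ.add hτ', fun a s hs => (hP a s hs).seq fun s' hs' =>
    (hP' _ s' hs').mono (hυτ' a _ le_rfl) fun _ => id⟩

end Lists

/-! ### Arithmetic and logic -/

section Arithmetic

variable {α β V : Type} [Layout α] [Slot β] [Register V] {f g : α → ℕ} {x y : α → ℝ}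
  {p q : α → Prop}

theorem computes_natVar {k : ℕ} (hk : k < Layout.width α)
    (h : ∀ a s, Layout.Holds a s → s.natVar k = f a) : Computes f := fun d hd =>
  ⟨Register.copy ℕ d k, _, polyBounded_const 2, fun a s hs =>
    (Register.runs_copy (hk.trans_le hd).ne s).mono le_rfl fun _ hs' => hs' ▸
      ⟨(Agree.refl _ _).setNat le_rfl _, (Register.get_set_self ..).trans (h a s hs)⟩⟩

theorem computes_natConst (c : ℕ) : Computes fun _ : α => c :=
  IsConst.computes ⟨(.natConst · c), fun _ _ => rfl⟩

theorem computes_realConst (c : ℚ) : Computes fun _ : α => (c : ℝ) :=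
  IsConst.computes ⟨(.realConst · c), fun _ _ => rfl⟩

theorem computes_zero : Computes fun _ : α => (0 : ℝ) := by
  simpa using computes_realConst (α := α) 0

theorem Computes.natAdd (hf : Computes f) (hg : Computes g) : Computes fun a => f a + g a :=
  IsOp.computes ⟨.natAdd, fun _ _ _ _ => rfl⟩ hf hg

theorem Computes.natSub (hf : Computes f) (hg : Computes g) : Computes fun a => f a - g a :=
  IsOp.computes ⟨.natSub, fun _ _ _ _ => rfl⟩ hf hg

theorem Computes.realAdd (hx : Computes x) (hy : Computes y) : Computes fun a => x a + y a :=
  IsOp.computes ⟨.realAdd, fun _ _ _ _ => rfl⟩ hx hy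

theorem Computes.realSub (hx : Computes x) (hy : Computes y) : Computes fun a => x a - y a :=
  IsOp.computes ⟨.realSub, fun _ _ _ _ => rfl⟩ hx hy

theorem Computes.realMul (hx : Computes x) (hy : Computes y) : Computes fun a => x a * y a :=
  IsOp.computes ⟨.realMul, fun _ _ _ _ => rfl⟩ hx hy

theorem Computes.realDiv (hx : Computes x) (hy : Computes y) : Computes fun a => x a / y a :=
  IsOp.computes ⟨.realDiv, fun _ _ _ _ => rfl⟩ hx hy

theorem Computes.natSum {f : α × ℕ → ℕ} (hf : Computes f) {ℓ : α → ℕ} (hℓ : IsLimit ℓ) :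
    Computes fun a => ∑ i ∈ Finset.range (ℓ a), f (a, i) :=
  .recursion ⟨.natAdd, fun _ _ _ _ => rfl⟩ ⟨(.natConst · 0), fun _ _ => rfl⟩ hf hℓ
    (fun a k => ∑ i ∈ Finset.range k, f (a, i)) (fun _ => Finset.sum_range_zero _)
    fun _ _ => Finset.sum_range_succ ..

theorem Computes.realSum {f : α × ℕ → ℝ} (hf : Computes f) {ℓ : α → ℕ} (hℓ : IsLimit ℓ) :
    Computes fun a => ∑ i ∈ Finset.range (ℓ a), f (a, i) :=
  .recursion (c := 0) ⟨.realAdd, fun _ _ _ _ => rfl⟩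
    ⟨(.realConst · 0), fun _ _ => by simp [Instr.run, Register.set]⟩ hf hℓ
    (fun a k => ∑ i ∈ Finset.range k, f (a, i)) (fun _ => Finset.sum_range_zero _)
    fun _ _ => Finset.sum_range_succ ..

theorem Computes.realProd {f : α × ℕ → ℝ} (hf : Computes f) {ℓ : α → ℕ} (hℓ : IsLimit ℓ) :
    Computes fun a => ∏ i ∈ Finset.range (ℓ a), f (a, i) :=
  .recursion (c := 1) ⟨.realMul, fun _ _ _ _ => rfl⟩
    ⟨(.realConst · 1), fun _ _ => by simp [Instr.run, Register.set]⟩ hf hℓ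
    (fun a k => ∏ i ∈ Finset.range k, f (a, i)) (fun _ => Finset.prod_range_zero _)
    fun _ _ => Finset.prod_range_succ ..

theorem Computes.congr {f g : α → V} (hf : Computes f) (h : ∀ a, g a = f a) : Computes g := by
  rwa [show g = f from funext h]

theorem Decides.congr (hp : Decides p) (h : ∀ a, q a ↔ p a) : Decides q := by
  rwa [show q = p from funext fun a => propext (h a)]

theorem decides_natLe (hf : Computes f) (hg : Computes g) : Decides fun a => f a ≤ g a :=
  IsTest.decides ⟨.natLe, fun _ _ _ => .rfl⟩ hf hg

theorem decides_natLt (hf : Computes f) (hg : Computes g) : Decides fun a => f a < g a :=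
  IsTest.decides ⟨.natLt, fun _ _ _ => .rfl⟩ hf hg

theorem decides_realLe (hx : Computes x) (hy : Computes y) : Decides fun a => x a ≤ y a :=
  IsTest.decides ⟨.realLe, fun _ _ _ => .rfl⟩ hx hy

theorem decides_realLt (hx : Computes x) (hy : Computes y) : Decides fun a => x a < y a :=
  IsTest.decides ⟨.realLt, fun _ _ _ => .rfl⟩ hx hy

theorem Decides.not (hp : Decides p) : Decides fun a => ¬ p a :=
  (hp.ite (computes_natConst 0) (computes_natConst 1)).congr fun a => by
    by_cases h : p a <;> simp [h]

theorem Decides.and (hp : Decides p) (hq : Decides q) : Decides fun a => p a ∧ q a :=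
  (hp.ite hq (computes_natConst 0)).congr fun a => by
    by_cases h : p a <;> by_cases h' : q a <;> simp [h, h']

theorem Decides.imp (hp : Decides p) (hq : Decides q) : Decides fun a => p a → q a :=
  (hp.and hq.not).not.congr fun _ => by tauto

theorem Decides.or (hp : Decides p) (hq : Decides q) : Decides fun a => p a ∨ q a :=
  (hp.not.imp hq).congr fun _ => or_iff_not_imp_left

theorem decides_natEq (hf : Computes f) (hg : Computes g) : Decides fun a => f a = g a :=
  ((decides_natLe hf hg).and (decides_natLe hg hf)).congr fun _ => le_antisymm_iff

theorem decides_realEq (hx : Computes x) (hy : Computes y) : Decides fun a => x a = y a :=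
  ((decides_realLe hx hy).and (decides_realLe hy hx)).congr fun _ => le_antisymm_iff

theorem decides_sign_eq (hx : Computes x) (s : SignType) :
    Decides fun a => SignType.sign (x a) = s := by
  cases s with
  | zero => exact (decides_realEq hx computes_zero).congr fun a => sign_eq_zero_iff
  | neg => exact (decides_realLt hx computes_zero).congr fun a => sign_eq_neg_one_iff
  | pos => exact (decides_realLt computes_zero hx).congr fun a => sign_eq_one_iff

theorem Decides.exists_lt {p : α × ℕ → Prop} (hp : Decides p) {ℓ : α → ℕ} (hℓ : IsLimit ℓ) :
    Decides fun a => ∃ i < ℓ a, p (a, i) := by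
  classical
  refine (decides_natLt (computes_natConst 0) (hp.natSum hℓ)).congr fun a => ?_
  simp [Nat.pos_iff_ne_zero]

theorem Decides.forall_lt {p : α × ℕ → Prop} (hp : Decides p) {ℓ : α → ℕ} (hℓ : IsLimit ℓ) :
    Decides fun a => ∀ i < ℓ a, p (a, i) :=
  (hp.not.exists_lt hℓ).not.congr fun _ => by push Not; rfl

theorem Computes.realMax (hx : Computes x) (hy : Computes y) :
    Computes fun a => max (x a) (y a) := by
  simpa only [max_def] using (decides_realLe hx hy).ite hy hx

theorem Computes.realMin (hx : Computes x) (hy : Computes y) :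
    Computes fun a => min (x a) (y a) := by
  simpa only [min_def] using (decides_realLe hx hy).ite hx hy

theorem isLimit_const (c : ℕ) : IsLimit fun _ : α => c :=
  ⟨computes_natConst c, polyBounded_const c⟩

theorem computes_snd : Computes fun x : α × ℕ => x.2 :=
  computes_natVar (Nat.lt_succ_self _) fun _ _ hs => hs.2

theorem isLimit_snd : IsLimit fun x : α × ℕ => x.2 :=
  ⟨computes_snd, polyBounded_slotSize⟩

theorem IsLimit.weaken (hf : IsLimit f) : IsLimit fun x : α × β => f x.1 :=
  ⟨hf.computes.weaken, hf.polyBounded.weaken⟩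

theorem IsLimit.add (hf : IsLimit f) (hg : IsLimit g) : IsLimit fun a => f a + g a :=
  ⟨hf.computes.natAdd hg.computes, hf.polyBounded.add hg.polyBounded⟩

theorem IsLimit.sub (hf : IsLimit f) (hg : IsLimit g) : IsLimit fun a => f a - g a :=
  ⟨hf.computes.natSub hg.computes, hf.polyBounded.mono fun _ => Nat.sub_le _ _⟩

theorem IsLimit.mul (hf : IsLimit f) (hg : IsLimit g) : IsLimit fun a => f a * g a :=
  ⟨by simpa using hg.computes.weaken.natSum hf, hf.polyBounded.mul hg.polyBounded⟩

theorem sum_mul_le_eq_div (t q : ℕ) (hq : 0 < q) :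
    ∑ k ∈ Finset.range t, (if (k + 1) * q ≤ t then 1 else 0) = t / q := by
  have : Finset.filter (fun k => (k + 1) * q ≤ t) (Finset.range t) = Finset.range (t / q) := by
    ext k
    simp only [Finset.mem_filter, Finset.mem_range, ← Nat.le_div_iff_mul_le hq, Nat.succ_le_iff]
    exact and_iff_right_of_imp fun h => h.trans_le (Nat.div_le_self t q)
  rw [Finset.sum_boole, this, Finset.card_range, Nat.cast_id]

theorem IsLimit.div (hf : IsLimit f) (hg : IsLimit g) : IsLimit fun a => f a / g a := by
  refine ⟨?_, hf.polyBounded.mono fun a => Nat.div_le_self _ _⟩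
  have hmul := ((isLimit_snd.add (isLimit_const 1)).mul hg.weaken).computes
  have hsum := (decides_natLe hmul hf.weaken.computes).natSum hf
  refine ((decides_natLt (computes_natConst 0) hg.computes).ite hsum
    (computes_natConst 0)).congr fun a => ?_
  split_ifs with h
  · rw [← sum_mul_le_eq_div _ _ h]
    exact Finset.sum_congr rfl fun _ _ => by congr
  · rw [Nat.eq_zero_of_not_pos h, Nat.div_zero]

theorem IsLimit.mod (hf : IsLimit f) (hg : IsLimit g) : IsLimit fun a => f a % g a :=
  ⟨by simpa only [Nat.mod_eq_sub_mul_div] using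
    hf.computes.natSub (hg.mul (hf.div hg)).computes, hf.polyBounded.mono fun a => Nat.mod_le _ _⟩

end Arithmetic

/-! ### Searching -/

/-- The least `t < L` with `p t`, and `L` if there is none. -/
noncomputable def firstIndex (p : ℕ → Prop) (L : ℕ) : ℕ :=
  sInf {t | L ≤ t ∨ p t}

theorem firstIndex_le (p : ℕ → Prop) (L : ℕ) : firstIndex p L ≤ L :=
  Nat.sInf_le (Or.inl le_rfl)

theorem firstIndex_spec {p : ℕ → Prop} {L : ℕ} (h : firstIndex p L < L) : p (firstIndex p L) :=
  (Nat.sInf_mem (s := {t | L ≤ t ∨ p t}) ⟨L, Or.inl le_rfl⟩).resolve_left h.not_ge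

theorem firstIndex_lt {p : ℕ → Prop} {t L : ℕ} (ht : t < L) (h : p t) : firstIndex p L < L :=
  (Nat.sInf_le (Or.inr h)).trans_lt ht

theorem lt_firstIndex_iff {p : ℕ → Prop} {t L : ℕ} :
    t < firstIndex p L ↔ t < L ∧ ∀ t' < t + 1, ¬ p t' := by
  refine ⟨fun h => ⟨h.trans_le (firstIndex_le p L), fun t' ht' hp =>
    Nat.notMem_of_lt_sInf ((Nat.le_of_lt_succ ht').trans_lt h) (Or.inr hp)⟩, fun ⟨h, hp⟩ => ?_⟩
  by_contra! hle
  exact hp _ (Nat.lt_succ_of_le hle) (firstIndex_spec (hle.trans_lt h))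

theorem firstIndex_eq_sum (p : ℕ → Prop) (L : ℕ) [DecidablePred fun t => ∀ t' < t + 1, ¬ p t'] :
    firstIndex p L = ∑ t ∈ Finset.range L, if ∀ t' < t + 1, ¬ p t' then 1 else 0 := by
  have : (Finset.range L).filter (fun t => ∀ t' < t + 1, ¬ p t') =
      Finset.range (firstIndex p L) := by
    ext t
    simp only [Finset.mem_filter, Finset.mem_range, lt_firstIndex_iff]
  rw [Finset.sum_boole, this, Finset.card_range, Nat.cast_id]

theorem getD_le_sum (l : List ℕ) (i : ℕ) : l.getD i 0 ≤ l.sum := by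
  rw [List.getD_eq_getElem?_getD]
  rcases lt_or_ge i l.length with h | h
  · simpa [h] using List.single_le_sum (by simp) _ (List.getElem_mem h)
  · simp [h]

section Access

variable {α β : Type} [Layout α] [Slot β] {i : α → ℕ}

/-- The real numbers `f a 0, f a 1, …` are kept in one of the real arrays, together with `a`. -/
def RealArray (f : α → ℕ → ℝ) : Prop :=
  ∃ k, ∀ a s, Layout.Holds a s → s.realArr k = f a

theorem RealArray.weaken {f : α → ℕ → ℝ} (hf : RealArray f) :
    RealArray fun x : α × β => f x.1 :=
  hf.imp fun _ h x s hs => h x.1 s hs.1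

theorem RealArray.computes {f : α → ℕ → ℝ} (hf : RealArray f) (hi : Computes i) :
    Computes fun a => f a (i a) := by
  intro d hd
  obtain ⟨k, hk⟩ := hf
  obtain ⟨P, τ, hτ, hP⟩ := hi d hd
  refine ⟨.seq P (.op (.realLoad d k d)), _, hτ.add (polyBounded_const 1), fun a s hs =>
    (hP a s hs).seq fun s' ⟨hs', h⟩ => .op ⟨hs'.setReal le_rfl _, ?_⟩⟩
  rw [get_nat] at h
  simp [Instr.run, State.setReal, h, hs'.realArr, hk a s hs]

/-- The list `l a` is kept in one of the slots that make up `a`. -/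
structure IsStored (l : α → List ℕ) : Prop where
  polyBounded : PolyBounded fun a => Slot.size (l a)
  stores : ∃ k < Layout.width α, ∀ a s, Layout.Holds a s → Slot.Stores (l a) k s

theorem isStored_snd : IsStored fun x : α × List ℕ => x.2 :=
  ⟨polyBounded_slotSize, Layout.width α, Nat.lt_succ_self _, fun _ _ hs => hs.2⟩

theorem IsStored.weaken {l : α → List ℕ} (hl : IsStored l) :
    IsStored fun x : α × β => l x.1 :=
  ⟨hl.polyBounded.weaken, hl.stores.imp fun _ ⟨hk, h⟩ =>
    ⟨hk.trans (Nat.lt_succ_self _), fun x s hs => h x.1 s hs.1⟩⟩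

theorem IsStored.isLimit_length {l : α → List ℕ} (hl : IsStored l) :
    IsLimit fun a => (l a).length :=
  let ⟨_, hk, h⟩ := hl.stores
  ⟨computes_natVar hk fun a s hs => (h a s hs).1, hl.polyBounded.mono fun _ => Nat.le_add_right _ _⟩

theorem IsStored.isLimit_getD {l : α → List ℕ} (hl : IsStored l) (hi : Computes i) :
    IsLimit fun a => (l a).getD (i a) 0 := by
  refine ⟨fun d hd => ?_, hl.polyBounded.mono fun a => (getD_le_sum _ _).trans (Nat.le_add_left ..)⟩
  obtain ⟨k, hk, h⟩ := hl.stores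
  obtain ⟨P, τ, hτ, hP⟩ := hi d hd
  refine ⟨.seq P (.branch (.natLt d k) (.op (.natLoad d k d)) (.op (.natConst d 0))), _,
    hτ.add (polyBounded_const 2), fun a s hs => (hP a s hs).seq fun s' ⟨hs', hval⟩ => ?_⟩
  obtain ⟨hlen, hent⟩ := h a s hs
  rw [get_nat] at hval
  have hlt : (Cond.natLt d k).Holds s' ↔ i a < (l a).length := by
    rw [← hlen, ← hs'.natVar k (by lia), ← hval]
    rfl
  refine Runs.branch (fun h => .op ⟨hs'.setNat le_rfl _, ?_⟩)
    fun h => .op ⟨hs'.setNat le_rfl _, ?_⟩ <;> rw [hlt] at h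
  · simp only [Instr.run, get_nat, State.natVar_setNat_self, hval, hs'.natArr k (by lia),
      hent _ h]
  · rw [List.getD_eq_default _ _ (not_lt.1 h)]
    exact State.natVar_setNat_self ..

theorem Decides.isLimit_firstIndex {p : α → ℕ → Prop}
    (hp : Decides fun x : (α × ℕ) × ℕ => p x.1.1 x.2) {ℓ : α → ℕ} (hℓ : IsLimit ℓ) :
    IsLimit fun a => firstIndex (p a) (ℓ a) := by
  classical
  refine ⟨?_, hℓ.polyBounded.mono fun a => firstIndex_le _ _⟩
  have hnone := (hp.not.forall_lt (isLimit_snd.add (isLimit_const 1))).natSum hℓ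
  refine hnone.congr fun a => (firstIndex_eq_sum (p a) (ℓ a)).trans ?_
  exact Finset.sum_congr rfl fun _ _ => by congr

end Access

end RealRAM

namespace ChainGuard

open Finset

/-! ### Fractional covers by multiplicative weights -/

section MultiplicativeWeights

variable {ι τ : Type*} (E : ι → τ → Prop) (G : Finset ι)

open Classical in
/-- The total value under `x` of the guards in `G` that are related to `t`. -/
noncomputable def load (x : ι → ℝ) (t : τ) : ℝ :=
  ∑ j ∈ G, if E j t then x j else 0

open Classical in
/-- The multiplicative weight of the guard `j` after the targets `p 0, …, p (k - 1)` have been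
presented: it doubles whenever `j` is related to the target. -/
noncomputable def weight (p : ℕ → τ) (k : ℕ) (j : ι) : ℝ :=
  ∏ r ∈ range k, if E j (p r) then 2 else 1

/-- The sum over `k < K` of the weights after `k` targets, scaled to a probability distribution
on `G`. -/
noncomputable def fractional (p : ℕ → τ) (K : ℕ) (j : ι) : ℝ :=
  ∑ k ∈ range K, weight E p k j / ∑ i ∈ G, weight E p k i

variable {E G} {p : ℕ → τ} {K : ℕ}

theorem exists_of_load_pos {x : ι → ℝ} {t : τ} (h : 0 < load E G x t) : ∃ j ∈ G, E j t := by
  classical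
  obtain ⟨j, hj, hne⟩ := exists_ne_zero_of_sum_ne_zero h.ne'
  exact ⟨j, hj, (ite_ne_right_iff.1 hne).1⟩

theorem weight_congr {p p' : ℕ → τ} {k : ℕ} (h : ∀ r < k, p r = p' r) :
    weight E p k = weight E p' k :=
  funext fun _ => prod_congr rfl fun r hr => by rw [h r (mem_range.1 hr)]

theorem load_nonneg {x : ι → ℝ} (hx : ∀ j, 0 ≤ x j) (t : τ) : 0 ≤ load E G x t := by
  classical
  exact sum_nonneg fun j _ => by split_ifs <;> simp [hx]

theorem one_le_weight (p : ℕ → τ) (k : ℕ) (j : ι) : 1 ≤ weight E p k j := by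
  classical
  exact one_le_prod fun r _ => by split_ifs <;> norm_num

theorem weight_pos (p : ℕ → τ) (k : ℕ) (j : ι) : 0 < weight E p k j :=
  one_pos.trans_le (one_le_weight p k j)

theorem sum_weight_pos (hG : G.Nonempty) (p : ℕ → τ) (k : ℕ) : 0 < ∑ j ∈ G, weight E p k j :=
  sum_pos (fun j _ => weight_pos p k j) hG

theorem fractional_nonneg (p : ℕ → τ) (K : ℕ) (j : ι) : 0 ≤ fractional E G p K j :=
  sum_nonneg fun k _ =>
    div_nonneg (weight_pos p k j).le (sum_nonneg fun i _ => (weight_pos p k i).le)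

theorem sum_fractional (hG : G.Nonempty) (p : ℕ → τ) (K : ℕ) :
    ∑ j ∈ G, fractional E G p K j = K := by
  simp only [fractional]
  rw [sum_comm]
  simp [← sum_div, div_self (sum_weight_pos hG p _).ne']

theorem load_fractional (p : ℕ → τ) (K : ℕ) (t : τ) :
    load E G (fractional E G p K) t =
      ∑ k ∈ range K, load E G (weight E p k) t / ∑ i ∈ G, weight E p k i := by
  classical
  simp only [load, fractional, sum_div]
  rw [sum_comm]
  exact sum_congr rfl fun j _ => by split_ifs <;> simp

theorem sum_weight_succ (p : ℕ → τ) (k : ℕ) :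
    ∑ j ∈ G, weight E p (k + 1) j = ∑ j ∈ G, weight E p k j + load E G (weight E p k) (p k) := by
  classical
  rw [load, ← sum_add_distrib]
  refine sum_congr rfl fun j _ => ?_
  rw [weight, prod_range_succ, ← weight]
  split_ifs <;> ring

theorem sum_weight_le (hG : G.Nonempty) {t : τ}
    (hp : ∀ k < K, load E G (weight E p k) (p k) ≤ load E G (weight E p k) t) :
    ∑ j ∈ G, weight E p K j ≤ #G * Real.exp (load E G (fractional E G p K) t) := by
  induction K with
  | zero => simp [load, fractional, weight]
  | succ K ih =>
    have hS := sum_weight_pos (E := E) hG p K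
    set S := ∑ j ∈ G, weight E p K j
    set ρ := load E G (weight E p K) t / S
    calc ∑ j ∈ G, weight E p (K + 1) j ≤ S + load E G (weight E p K) t := by
          rw [sum_weight_succ]
          gcongr
          exact hp K (Nat.lt_succ_self K)
      _ = S * (ρ + 1) := by rw [mul_add, mul_div_cancel₀ _ hS.ne']; ring
      _ ≤ #G * Real.exp (load E G (fractional E G p K) t) * Real.exp ρ := by
          have hρ : 0 ≤ ρ := div_nonneg (load_nonneg (fun j => (weight_pos p K j).le) t) hS.le
          gcongr
          · exact ih fun k hk => hp k (hk.trans (Nat.lt_succ_self K))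
          · exact Real.add_one_le_exp ρ
      _ = _ := by rw [mul_assoc, ← Real.exp_add, load_fractional, load_fractional, sum_range_succ]

theorem two_pow_le_sum_weight_pow {H : Finset ι} (hHG : H ⊆ G)
    (hH : ∀ k < K, ∃ j ∈ H, E j (p k)) : 2 ^ K ≤ (∑ j ∈ G, weight E p K j) ^ #H := by
  classical
  calc (2 : ℝ) ^ K = ∏ _k ∈ range K, 2 := by simp
    _ ≤ ∏ k ∈ range K, ∏ j ∈ H, if E j (p k) then (2 : ℝ) else 1 := by
        refine prod_le_prod (fun _ _ => zero_le_two) fun k hk => ?_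
        obtain ⟨j, hj, hE⟩ := hH k (mem_range.1 hk)
        rw [← mul_prod_erase H _ hj, if_pos hE]
        exact le_mul_of_one_le_right zero_le_two
          (one_le_prod fun i _ => by split_ifs <;> norm_num)
    _ = ∏ j ∈ H, weight E p K j := prod_comm
    _ ≤ ∏ _j ∈ H, ∑ j ∈ G, weight E p K j :=
        prod_le_prod (fun j _ => (weight_pos p K j).le) fun j hj =>
          single_le_sum (fun i _ => (weight_pos p K i).le) (hHG hj)
    _ = _ := prod_const _

/-- With `6 (#G)²` rounds the error term `#H * log #G` is at most a sixth of the number of rounds,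
and `log 2 - 1 / 6 ≥ 1 / 2`. -/
theorem rounds_le_two_mul_card_mul_load {H : Finset ι} (hG : G.Nonempty) (hHG : H ⊆ G) {t : τ}
    (hK : K = 6 * #G ^ 2) (hH : ∀ k < K, ∃ j ∈ H, E j (p k))
    (hp : ∀ k < K, load E G (weight E p k) (p k) ≤ load E G (weight E p k) t) :
    (K : ℝ) ≤ 2 * #H * load E G (fractional E G p K) t := by
  set L := load E G (fractional E G p K) t
  have hcard : (0 : ℝ) < #G := by exact_mod_cast hG.card_pos
  have hlog : Real.log (∑ j ∈ G, weight E p K j) ≤ #G + L := by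
    calc _ ≤ Real.log (#G * Real.exp L) :=
          Real.log_le_log (sum_weight_pos hG p K) (sum_weight_le hG hp)
      _ = Real.log #G + L := by rw [Real.log_mul hcard.ne' (Real.exp_ne_zero L), Real.log_exp]
      _ ≤ #G + L := by linarith [Real.log_le_sub_one_of_pos hcard]
  have hK2 : K * Real.log 2 ≤ #H * (#G + L) := by
    calc K * Real.log 2 = Real.log (2 ^ K) := (Real.log_pow 2 K).symm
      _ ≤ Real.log ((∑ j ∈ G, weight E p K j) ^ #H) :=
          Real.log_le_log (by positivity) (two_pow_le_sum_weight_pow hHG hH)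
      _ ≤ #H * (#G + L) := by rw [Real.log_pow]; gcongr
  have hsq : (#H : ℝ) * #G ≤ K / 6 := by
    have : (#H : ℝ) ≤ #G := by exact_mod_cast card_le_card hHG
    rw [hK]
    push_cast
    nlinarith
  nlinarith [Real.log_two_gt_d9, (Nat.cast_nonneg K : (0 : ℝ) ≤ K)]

end MultiplicativeWeights

/-! ### Greedy selection for nested relations -/

theorem card_mul_le_sum_of_pairwiseDisjoint {ι κ : Type*} {C : Finset ι} {G : Finset κ}
    {cov : ι → Finset κ} (hdisj : (C : Set ι).PairwiseDisjoint cov)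
    (hcov : ∀ j ∈ C, cov j ⊆ G) {x : κ → ℝ} (hx : ∀ i ∈ G, 0 ≤ x i) {θ : ℝ}
    (hθ : ∀ j ∈ C, θ ≤ ∑ i ∈ cov j, x i) : #C * θ ≤ ∑ i ∈ G, x i := by
  classical
  calc #C * θ = ∑ _j ∈ C, θ := by simp
    _ ≤ ∑ j ∈ C, ∑ i ∈ cov j, x i := sum_le_sum hθ
    _ = ∑ i ∈ C.biUnion cov, x i := (sum_biUnion hdisj).symm
    _ ≤ ∑ i ∈ G, x i := sum_le_sum_of_subset_of_nonneg (biUnion_subset.2 hcov) fun i hi _ => hx i hi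

/-- A covering problem on the guards below `m` and the targets below `M`, of which only the active
ones have to be covered, together with the orders in which targets and guards are considered. -/
structure Cover where
  m : ℕ
  M : ℕ
  /-- the guard `j` covers the target `t` -/
  Covers : ℕ → ℕ → Prop
  IsActive : ℕ → Prop
  guardKey : ℕ → ℝ
  targetKey : ℕ → ℝ

namespace Cover

variable (S : Cover)

/-- Among the guards that cover a target `t`, one that comes earlier than some guard that covers
both `t` and a later target `t'` covers `t'` as well. -/
def IsNested : Prop :=
  ∀ ⦃i j t t'⦄, i < S.m → j < S.m → S.Covers j t → S.Covers j t' →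
    S.targetKey t ≤ S.targetKey t' → S.Covers i t → S.guardKey i ≤ S.guardKey j → S.Covers i t'

/-- The active target `t` is covered by none of the guards `q 0, …, q (k - 1)`. -/
def IsOpen (q : ℕ → ℕ) (k t : ℕ) : Prop :=
  S.IsActive t ∧ ∀ r < k, ¬ S.Covers (q r) t

/-- The guard `j` is a greedy choice after `q 0, …, q (k - 1)`, made on behalf of the target `t`:
`t` is an open target with least key, and `j` a guard with least key among those that cover `t`. -/
structure IsChoice (q : ℕ → ℕ) (k t j : ℕ) : Prop where
  isOpen : S.IsOpen q k t
  targetKey_le : ∀ t' < S.M, S.IsOpen q k t' → S.targetKey t ≤ S.targetKey t'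
  covers : S.Covers j t
  guardKey_le : ∀ i < S.m, S.Covers i t → S.guardKey j ≤ S.guardKey i

/-- The first greedy choice, with the value `S.m` if there is none. -/
noncomputable def choice (q : ℕ → ℕ) (k : ℕ) : ℕ :=
  RealRAM.firstIndex (fun j => ∃ t < S.M, S.IsChoice q k t j) S.m

variable {S} {q : ℕ → ℕ} {k t : ℕ}

theorem isChoice_iff {j : ℕ} : S.IsChoice q k t j ↔ S.IsOpen q k t ∧
    (∀ t' < S.M, S.IsOpen q k t' → S.targetKey t ≤ S.targetKey t') ∧ S.Covers j t ∧
      ∀ i < S.m, S.Covers i t → S.guardKey j ≤ S.guardKey i :=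
  ⟨fun ⟨h₁, h₂, h₃, h₄⟩ => ⟨h₁, h₂, h₃, h₄⟩, fun ⟨h₁, h₂, h₃, h₄⟩ => ⟨h₁, h₂, h₃, h₄⟩⟩

theorem choice_congr {q' : ℕ → ℕ} (h : ∀ r < k, q r = q' r) : S.choice q k = S.choice q' k := by
  have hopen : ∀ t, S.IsOpen q k t ↔ S.IsOpen q' k t := fun t =>
    and_congr_right' (forall₂_congr fun r hr => by rw [h r hr])
  simp only [choice, isChoice_iff, hopen]

theorem choice_lt (hcov : ∀ t < S.M, S.IsActive t → ∃ j < S.m, S.Covers j t) (ht : t < S.M)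
    (hopen : S.IsOpen q k t) : S.choice q k < S.m := by
  classical
  obtain ⟨t₀, ht₀, hmin⟩ := exists_min_image {t ∈ range S.M | S.IsOpen q k t} S.targetKey
    ⟨t, by simp [ht, hopen]⟩
  simp only [mem_filter, mem_range] at ht₀ hmin
  obtain ⟨j, hj, hjt⟩ := hcov t₀ ht₀.1 ht₀.2.1
  obtain ⟨j₀, hj₀, hmin'⟩ := exists_min_image {j ∈ range S.m | S.Covers j t₀} S.guardKey
    ⟨j, by simp [hj, hjt]⟩
  simp only [mem_filter, mem_range] at hj₀ hmin'
  exact RealRAM.firstIndex_lt hj₀.1 ⟨t₀, ht₀.1, ht₀.2, fun t' ht' h => hmin t' ⟨ht', h⟩, hj₀.2,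
    fun i hi h => hmin' i ⟨hi, h⟩⟩

theorem exists_isChoice (h : S.choice q k < S.m) : ∃ t < S.M, S.IsChoice q k t (S.choice q k) :=
  RealRAM.firstIndex_spec h

theorem IsChoice.ne (h : S.IsChoice q k t (q k)) {r : ℕ} (hr : r < k) : q r ≠ q k :=
  fun heq => h.isOpen.2 r hr (heq ▸ h.covers)

theorem exists_covers_of_isActive (hcov : ∀ t < S.M, S.IsActive t → ∃ j < S.m, S.Covers j t)
    (hq : ∀ k < S.m, q k = S.choice q k) (ht : t < S.M) (hact : S.IsActive t) :
    ∃ r < S.m, q r < S.m ∧ S.Covers (q r) t := by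
  by_contra! hnot
  have hlt : ∀ r < S.m, q r < S.m := by
    intro r
    induction r using Nat.strong_induction_on with
    | _ r ih =>
      intro hr
      rw [hq r hr]
      exact choice_lt hcov ht
        ⟨hact, fun r' hr' => hnot r' (hr'.trans hr) (ih r' hr' (hr'.trans hr))⟩
  have hne : ∀ r < S.m, ∀ r' < r, q r' ≠ q r := by
    intro r hr r' hr'
    obtain ⟨t, -, h⟩ := exists_isChoice (hq r hr ▸ hlt r hr)
    exact (hq r hr ▸ h).ne hr'
  have hinj : Set.InjOn q (range S.m) := by
    intro r hr r' hr' heq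
    simp only [coe_range, Set.mem_Iio] at hr hr'
    rcases lt_trichotomy r r' with h | h | h
    exacts [(hne r' hr' r h heq).elim, h, (hne r hr r' h heq.symm).elim]
  obtain ⟨j, hj, hjt⟩ := hcov t ht hact
  obtain ⟨r, hr, rfl⟩ := surjOn_of_injOn_of_card_le q
    (fun r hr => by simpa using hlt r (by simpa using hr)) hinj le_rfl
    (by simpa using hj : j ∈ (range S.m : Set ℕ))
  exact hnot r (by simpa using hr) hj hjt

/-- Because the open targets are considered in order, nestedness prevents a guard from covering two
targets on whose behalf choices were made. -/
theorem IsNested.not_covers (hS : S.IsNested) {r t' i : ℕ} (hr : r < k) (hqr : q r < S.m)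
    (ht' : t' < S.M) (h : S.IsChoice q r t (q r)) (h' : S.IsOpen q k t') (hi : i < S.m)
    (hit : S.Covers i t) : ¬ S.Covers i t' := fun hit' =>
  h'.2 r hr <| hS hqr hi hit hit'
    (h.targetKey_le t' ht' ⟨h'.1, fun r' hr' => h'.2 r' (hr'.trans hr)⟩) h.covers
    (h.guardKey_le i hi hit)

variable (S q) in
/-- The guards chosen in the first `S.m` rounds. -/
noncomputable def chosen : Finset ℕ :=
  {j ∈ range S.m | ∃ r < S.m, q r = j}

theorem IsNested.card_chosen_mul_le (hS : S.IsNested) (hq : ∀ k < S.m, q k = S.choice q k)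
    {x : ℕ → ℝ} (hx : ∀ j, 0 ≤ x j) {θ : ℝ}
    (hθ : ∀ t < S.M, S.IsActive t → θ ≤ load S.Covers (range S.m) x t) :
    #(S.chosen q) * θ ≤ ∑ j ∈ range S.m, x j := by
  classical
  have hwit : ∀ j ∈ S.chosen q, ∃ r t, q r = j ∧ q r < S.m ∧ t < S.M ∧ S.IsChoice q r t (q r) := by
    intro j hj
    obtain ⟨hjm, r, hr, rfl⟩ : j < S.m ∧ ∃ r < S.m, q r = j := by simpa [chosen] using hj
    obtain ⟨t, ht, h⟩ := exists_isChoice (hq r hr ▸ hjm)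
    exact ⟨r, t, rfl, hjm, ht, hq r hr ▸ h⟩
  choose! round target hround hmem htarget hchoice using hwit
  let cov (j : ℕ) : Finset ℕ := {i ∈ range S.m | S.Covers i (target j)}
  have hlt : ∀ j ∈ S.chosen q, ∀ j' ∈ S.chosen q, round j < round j' →
      Disjoint (cov j) (cov j') := by
    intro j hj j' hj' hjj'
    refine disjoint_left.2 fun i hi hi' => ?_
    simp only [cov, mem_filter, mem_range] at hi hi'
    exact hS.not_covers hjj' (hmem j hj) (htarget j' hj') (hchoice j hj) (hchoice j' hj').isOpen
      hi.1 hi.2 hi'.2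
  have hdisj : (S.chosen q : Set ℕ).PairwiseDisjoint cov := by
    intro j hj j' hj' hne
    rcases lt_trichotomy (round j) (round j') with h | h | h
    · exact hlt j hj j' hj' h
    · exact (hne (by rw [← hround j hj, ← hround j' hj', h])).elim
    · exact (hlt j' hj' j hj h).symm
  refine card_mul_le_sum_of_pairwiseDisjoint hdisj (fun j _ => filter_subset _ _)
    (fun i _ => hx i) fun j hj => ?_
  simpa only [load, cov, sum_filter] using hθ _ (htarget j hj) (hchoice j hj).isOpen.1

end Cover

end ChainGuard

namespace ChainGuard

open Set AffineMap

/-! ### Visibility above the graph of a function -/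

/-- The points of the graph of `f` above `a` and `c` see each other over the graph: the chord
between them is nowhere below the graph. -/
def Visible (f : ℝ → ℝ) (a c : ℝ) : Prop :=
  ∀ s ∈ Icc (0 : ℝ) 1, f (lineMap a c s) ≤ lineMap (f a) (f c) s

/-- The height of the chord over `a, c` above the graph of `f` at `y`, multiplied by `c - a`. -/
def cross (f : ℝ → ℝ) (a c y : ℝ) : ℝ :=
  (f c - f a) * (y - a) - (f y - f a) * (c - a)

section Visible

variable {f : ℝ → ℝ} {a b c d : ℝ}

theorem visible_comm : Visible f a c ↔ Visible f c a := by
  suffices ∀ {a c}, Visible f a c → Visible f c a from ⟨this, this⟩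
  intro a c h s hs
  rw [← lineMap_apply_one_sub a c, ← lineMap_apply_one_sub (f a) (f c)]
  exact h (1 - s) ⟨sub_nonneg.2 hs.2, sub_le_self 1 hs.1⟩

theorem cross_comm (f : ℝ → ℝ) (a c y : ℝ) : cross f c a y = -cross f a c y := by
  unfold cross
  ring

theorem visible_self (f : ℝ → ℝ) (a : ℝ) : Visible f a a := fun s _ => by simp

theorem visible_iff_cross (hac : a < c) : Visible f a c ↔ ∀ y ∈ Icc a c, 0 ≤ cross f a c y := by
  have hiff : ∀ s : ℝ, 0 ≤ cross f a c (lineMap a c s) ↔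
      f (lineMap a c s) ≤ lineMap (f a) (f c) s := by
    intro s
    have : cross f a c (lineMap a c s) = (lineMap (f a) (f c) s - f (lineMap a c s)) * (c - a) := by
      simp only [cross, lineMap_apply_ring']
      ring
    rw [this, mul_nonneg_iff_of_pos_right (sub_pos.2 hac), sub_nonneg]
  rw [← segment_eq_Icc hac.le, segment_eq_image_lineMap, forall_mem_image]
  exact forall₂_congr fun s _ => (hiff s).symm

theorem Visible.cross_mul_le_left (hac : a < c) (hcd : c ≤ d) (h : Visible f a c) {y : ℝ}
    (hy : y ∈ Icc a c) : cross f a d c * (y - a) ≤ cross f a d y * (c - a) := by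
  have hid : cross f a d y * (c - a) - cross f a d c * (y - a) = cross f a c y * (d - a) := by
    unfold cross
    ring
  have hcross := (visible_iff_cross hac).1 h y hy
  linarith [mul_nonneg hcross (sub_nonneg.2 (hac.le.trans hcd))]

theorem Visible.cross_mul_le_right (hab : a ≤ b) (hbd : b < d) (h : Visible f b d) {y : ℝ}
    (hy : y ∈ Icc b d) : cross f a d b * (d - y) ≤ cross f a d y * (d - b) := by
  have hid : cross f a d y * (d - b) - cross f a d b * (d - y) = cross f b d y * (d - a) := by
    unfold cross
    ring
  have hcross := (visible_iff_cross hbd).1 h y hy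
  linarith [mul_nonneg hcross (sub_nonneg.2 (hab.trans hbd.le))]

theorem Visible.of_le_of_le (hab : a ≤ b) (hbc : b < c) (hcd : c ≤ d) (hac : Visible f a c)
    (hbd : Visible f b d) : Visible f a d := by
  have hleft {y} := hac.cross_mul_le_left (hab.trans_lt hbc) hcd (y := y)
  have hright {y} := hbd.cross_mul_le_right hab (hbc.trans_le hcd) (y := y)
  rw [visible_iff_cross (by linarith)]
  have hb := hleft ⟨hab, hbc.le⟩
  have hc := hright ⟨hbc.le, hcd⟩
  have hc₀ : 0 ≤ cross f a d c := by
    by_contra! hneg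
    have hb₀ : cross f a d b < 0 := by nlinarith
    have hlt : cross f a d c < cross f a d b := by
      refine lt_of_mul_lt_mul_right (a := c - a) ?_ (by linarith)
      linarith [mul_pos_of_neg_of_neg hneg (sub_neg.2 hbc)]
    have hgt : cross f a d b < cross f a d c := by
      refine lt_of_mul_lt_mul_right (a := d - b) ?_ (by linarith)
      linarith [mul_pos_of_neg_of_neg hb₀ (sub_neg.2 hbc)]
    exact hlt.not_gt hgt
  have hb₀ : 0 ≤ cross f a d b := by
    by_contra! hneg
    nlinarith
  intro y hy
  rcases le_total y c with hyc | hyc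
  · have := hleft ⟨hy.1, hyc⟩
    exact nonneg_of_mul_nonneg_left
      ((mul_nonneg hc₀ (sub_nonneg.2 hy.1)).trans this) (by linarith)
  · have := hright ⟨by linarith, hy.2⟩
    exact nonneg_of_mul_nonneg_left
      ((mul_nonneg hb₀ (sub_nonneg.2 hy.2)).trans this) (by linarith)

end Visible

/-! ### Terrains -/

/-- The data of an `x`-monotone chain: the number of vertices and their coordinates, which are
irrelevant from index `n` on. -/
structure Terrain where
  n : ℕ
  X : ℕ → ℝ
  Y : ℕ → ℝ

namespace Terrain

variable (T : Terrain)

/-- The abscissas of the vertices `0, …, T.n - 1` are strictly increasing. -/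
def IsMonotone : Prop :=
  ∀ ⦃i j⦄, i < j → j < T.n → T.X i < T.X j

/-- The function whose graph is the chain.  Each edge contributes its slope times the length of its
part to the left of `x`. -/
noncomputable def height (x : ℝ) : ℝ :=
  T.Y 0 + ∑ e ∈ Finset.range (T.n - 1), (T.Y (e + 1) - T.Y e) / (T.X (e + 1) - T.X e) *
    (max (T.X e) (min x (T.X (e + 1))) - T.X e)

variable {T} {x a c : ℝ} {e i j : ℕ}

theorem IsMonotone.le (hT : T.IsMonotone) (hij : i ≤ j) (hj : j < T.n) : T.X i ≤ T.X j := by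
  rcases hij.eq_or_lt with rfl | hij
  exacts [le_rfl, (hT hij hj).le]

theorem IsMonotone.mem_Icc (hT : T.IsMonotone) (hi : i < T.n) :
    T.X i ∈ Icc (T.X 0) (T.X (T.n - 1)) :=
  ⟨hT.le (Nat.zero_le i) hi, hT.le (by lia) (by lia)⟩

theorem exists_edge (T : Terrain) (hx : x ∈ Ioc (T.X 0) (T.X (T.n - 1))) :
    ∃ e, e + 1 < T.n ∧ x ∈ Ioc (T.X e) (T.X (e + 1)) := by
  suffices ∀ k, x ≤ T.X k → ∃ e < k, x ∈ Ioc (T.X e) (T.X (e + 1)) from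
    let ⟨e, he, h⟩ := this _ hx.2
    ⟨e, by lia, h⟩
  intro k hk
  induction k with
  | zero => exact absurd hk hx.1.not_ge
  | succ k ih =>
    rcases le_or_gt x (T.X k) with h | h
    · obtain ⟨e, he, hex⟩ := ih h
      exact ⟨e, by lia, hex⟩
    · exact ⟨k, k.lt_succ_self, h, hk⟩

theorem IsMonotone.height_of_mem_Icc (hT : T.IsMonotone) (he : e + 1 < T.n)
    (hx : x ∈ Icc (T.X e) (T.X (e + 1))) :
    T.height x = T.Y e + (T.Y (e + 1) - T.Y e) / (T.X (e + 1) - T.X e) * (x - T.X e) := by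
  have hleft : ∀ k < e, max (T.X k) (min x (T.X (k + 1))) = T.X (k + 1) := fun k hk => by
    rw [min_eq_right ((hT.le hk (by lia)).trans hx.1), max_eq_right (hT.le k.le_succ (by lia))]
  have hright : ∀ k, e < k → k + 1 < T.n → max (T.X k) (min x (T.X (k + 1))) = T.X k :=
    fun k hk hkn => max_eq_left ((min_le_left _ _).trans (hx.2.trans (hT.le hk (by lia))))
  have htel : ∀ k ≤ e, ∑ r ∈ Finset.range k, (T.Y (r + 1) - T.Y r) / (T.X (r + 1) - T.X r) *
      (max (T.X r) (min x (T.X (r + 1))) - T.X r) = T.Y k - T.Y 0 := by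
    intro k hk
    rw [← Finset.sum_range_sub]
    refine Finset.sum_congr rfl fun r hr => ?_
    have hr := Finset.mem_range.1 hr
    rw [hleft r (by lia), div_mul_cancel₀]
    exact (sub_pos.2 (hT r.lt_succ_self (by lia))).ne'
  rw [height, ← Finset.sum_range_add_sum_Ico _ (show e + 1 ≤ T.n - 1 by lia),
    Finset.sum_range_succ, htel e le_rfl, Finset.sum_eq_zero (s := Finset.Ico _ _),
    min_eq_left hx.2, max_eq_right hx.1]
  · ring
  · intro k hk
    rw [Finset.mem_Ico] at hk
    rw [hright k (by lia) (by lia), sub_self, mul_zero]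

theorem IsMonotone.height_vertex (hT : T.IsMonotone) (hi : i < T.n) : T.height (T.X i) = T.Y i := by
  rcases i with _ | e
  · rcases (show T.n = 1 ∨ 0 + 1 < T.n by lia) with hn | hn
    · simp [height, hn]
    · rw [hT.height_of_mem_Icc hn ⟨le_rfl, (hT zero_lt_one hn).le⟩, sub_self, mul_zero, add_zero]
  · have hlt := hT e.lt_succ_self hi
    rw [hT.height_of_mem_Icc hi ⟨hlt.le, le_rfl⟩, div_mul_cancel₀ _ (sub_pos.2 hlt).ne',
      add_sub_cancel]

theorem IsMonotone.cross_affine (hT : T.IsMonotone) (he : e + 1 < T.n) (a c : ℝ) :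
    ∃ α β, ∀ y ∈ Icc (T.X e) (T.X (e + 1)), cross T.height a c y = α + β * y := by
  set σ := (T.Y (e + 1) - T.Y e) / (T.X (e + 1) - T.X e)
  refine ⟨-(T.height c - T.height a) * a - (T.Y e - σ * T.X e - T.height a) * (c - a),
    (T.height c - T.height a) - σ * (c - a), fun y hy => ?_⟩
  rw [cross, hT.height_of_mem_Icc he hy]
  ring

theorem IsMonotone.cross_affine_endpoint (hT : T.IsMonotone) (he : e + 1 < T.n) (a y : ℝ) :
    ∃ α β, ∀ c ∈ Icc (T.X e) (T.X (e + 1)), cross T.height a c y = α + β * c := by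
  set σ := (T.Y (e + 1) - T.Y e) / (T.X (e + 1) - T.X e)
  refine ⟨(T.Y e - σ * T.X e - T.height a) * (y - a) + (T.height y - T.height a) * a,
    σ * (y - a) - (T.height y - T.height a), fun c hc => ?_⟩
  rw [cross, hT.height_of_mem_Icc he hc]
  ring

variable (T) in
/-- No vertex strictly between `a` and `c` is above the chord over `a, c`. -/
def IsClear (a c : ℝ) : Prop :=
  ∀ i < T.n, (T.X i - a) * (T.X i - c) < 0 → 0 ≤ cross T.height a c (T.X i) * (c - a)

theorem isClear_comm : T.IsClear a c ↔ T.IsClear c a := by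
  unfold IsClear
  simp only [cross_comm _ a c, mul_comm (_ - a) (_ - c), neg_mul, ← mul_neg, neg_sub]

theorem IsMonotone.visible_of_isClear (hT : T.IsMonotone) (hac : a < c) (ha : T.X 0 ≤ a)
    (hc : c ≤ T.X (T.n - 1)) (h : T.IsClear a c) : Visible T.height a c := by
  have hvertex : ∀ i < T.n, a < T.X i → T.X i < c → 0 ≤ cross T.height a c (T.X i) :=
    fun i hi hai hic => nonneg_of_mul_nonneg_left
      (h i hi (mul_neg_of_pos_of_neg (sub_pos.2 hai) (sub_neg.2 hic))) (sub_pos.2 hac)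
  refine (visible_iff_cross hac).2 fun y hy => ?_
  rcases hy.1.eq_or_lt with rfl | hay
  · simp [cross]
  obtain ⟨e, he, hye⟩ := T.exists_edge ⟨ha.trans_lt hay, hy.2.trans hc⟩
  have hye' := Ioc_subset_Icc_self hye
  obtain ⟨α, β, haff⟩ := hT.cross_affine he a c
  have hl : 0 ≤ α + β * max a (T.X e) := by
    rw [← haff _ ⟨le_max_right _ _, max_le (hay.le.trans hye.2) (hye.1.le.trans hye.2)⟩]
    rcases le_or_gt (T.X e) a with hea | hea
    · simp [hea, cross]
    · rw [max_eq_right hea.le]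
      exact hvertex e (by lia) hea (hye.1.trans_le hy.2)
  have hr : 0 ≤ α + β * min c (T.X (e + 1)) := by
    rw [← haff _ ⟨le_min (hye.1.le.trans hy.2) (hye.1.le.trans hye.2), min_le_right _ _⟩]
    rcases le_or_gt c (T.X (e + 1)) with hea | hea
    · simp [hea, cross, mul_comm]
    · rw [min_eq_right hea.le]
      exact hvertex (e + 1) he (hay.trans_le hye.2) hea
  rw [haff y hye']
  rcases le_total 0 β with hβ | hβ
  · exact hl.trans (by gcongr; exact max_le hay.le hye.1.le)
  · exact hr.trans (add_le_add_right
      (mul_le_mul_of_nonpos_left (le_min hy.2 hye.2) hβ) α)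

theorem IsMonotone.visible_iff_isClear (hT : T.IsMonotone) (ha : a ∈ Icc (T.X 0) (T.X (T.n - 1)))
    (hc : c ∈ Icc (T.X 0) (T.X (T.n - 1))) : Visible T.height a c ↔ T.IsClear a c := by
  wlog hac : a ≤ c generalizing a c
  · rw [visible_comm, isClear_comm]
    exact this hc ha (le_of_not_ge hac)
  rcases hac.eq_or_lt with rfl | hac
  · exact iff_of_true (visible_self _ _) fun i _ _ => by simp
  refine ⟨fun h i _ hi => mul_nonneg ((visible_iff_cross hac).1 h _ ?_) (sub_pos.2 hac).le,
    hT.visible_of_isClear hac ha.1 hc.2⟩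
  constructor <;> nlinarith

end Terrain

/-! ### Visibility over a chain -/

namespace Terrain

variable {T : Terrain} {e : ℕ}

theorem IsMonotone.mem_segment_iff (hT : T.IsMonotone) (he : e + 1 < T.n) {p : ℝ × ℝ} :
    p ∈ segment ℝ (T.X e, T.Y e) (T.X (e + 1), T.Y (e + 1)) ↔
      p.1 ∈ Icc (T.X e) (T.X (e + 1)) ∧ p.2 = T.height p.1 := by
  have hlt := hT e.lt_succ_self he
  have hheight : ∀ s ∈ Icc (0 : ℝ) 1,
      T.height (lineMap (T.X e) (T.X (e + 1)) s) = lineMap (T.Y e) (T.Y (e + 1)) s := by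
    intro s hs
    have hmem : lineMap (T.X e) (T.X (e + 1)) s ∈ Icc (T.X e) (T.X (e + 1)) := by
      rw [← segment_eq_Icc hlt.le, segment_eq_image_lineMap]
      exact mem_image_of_mem _ hs
    rw [hT.height_of_mem_Icc he hmem, lineMap_apply_ring', lineMap_apply_ring']
    field [(sub_pos.2 hlt).ne']
  rw [segment_eq_image_lineMap, ← segment_eq_Icc hlt.le, segment_eq_image_lineMap]
  constructor
  · rintro ⟨s, hs, rfl⟩
    simp only [fst_lineMap, snd_lineMap]
    exact ⟨mem_image_of_mem _ hs, (hheight s hs).symm⟩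
  · rintro ⟨⟨s, hs, hx⟩, hy⟩
    refine ⟨s, hs, Prod.ext ?_ ?_⟩
    · rw [fst_lineMap, hx]
    · rw [snd_lineMap, hy, ← hx, hheight s hs]

end Terrain

theorem extend_apply {n : ℕ} (f : Fin n → ℝ) (i : Fin n) : extend f i = f i := by
  simp [extend]

variable {n m : ℕ} {v : Fin n → ℝ × ℝ} {g p : ℝ × ℝ}

variable (v) in
/-- The terrain whose graph is the chain with vertices `v`. -/
def terrain : Terrain := ⟨n, extend fun i => (v i).1, extend fun i => (v i).2⟩

theorem vertex_eq (v : Fin n → ℝ × ℝ) (i : Fin n) : v i = ((terrain v).X i, (terrain v).Y i) := by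
  simp [terrain, extend_apply]

theorem IsXMonotone.isMonotone (hv : IsXMonotone v) : (terrain v).IsMonotone := by
  intro i j hij hj
  simpa [vertex_eq v] using hv (a := ⟨i, hij.trans hj⟩) (b := ⟨j, hj⟩) hij

theorem IsXMonotone.mem_chain_iff (hv : IsXMonotone v) (hn : 0 < n) :
    p ∈ chain v ↔ p.1 ∈ Icc ((terrain v).X 0) ((terrain v).X (n - 1)) ∧
      p.2 = (terrain v).height p.1 := by
  have hT := hv.isMonotone
  set T := terrain v
  constructor
  · rintro (⟨i, rfl⟩ | ⟨i, j, hij, hp⟩)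
    · rw [vertex_eq v]
      exact ⟨hT.mem_Icc i.2, (hT.height_vertex i.2).symm⟩
    · have he : (i : ℕ) + 1 < T.n := hij ▸ j.2
      rw [vertex_eq v i, vertex_eq v j, ← hij, hT.mem_segment_iff he] at hp
      exact ⟨Icc_subset_Icc (hT.mem_Icc i.2).1 (hT.mem_Icc he).2 hp.1, hp.2⟩
  · rintro ⟨hx, hy⟩
    rcases hx.1.eq_or_lt with heq | hlt
    · refine Or.inl ⟨⟨0, hn⟩, ?_⟩
      rw [vertex_eq v]
      exact Prod.ext heq (by rw [hy, ← heq]; exact (hT.height_vertex hn).symm)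
    · obtain ⟨e, he, hxe⟩ := T.exists_edge ⟨hlt, hx.2⟩
      refine Or.inr ⟨⟨e, by exact (Nat.lt_succ_self e).trans he⟩, ⟨e + 1, he⟩, rfl, ?_⟩
      rw [vertex_eq v, vertex_eq v]
      exact (hT.mem_segment_iff he).2 ⟨Ioc_subset_Icc_self hxe, hy⟩

theorem IsXMonotone.sees_of_visible (hv : IsXMonotone v) (hn : 0 < n) (hg : g ∈ chain v)
    (hp : (terrain v).height p.1 ≤ p.2) (h : Visible (terrain v).height g.1 p.1) :
    Sees v g p := by
  refine disjoint_left.2 ?_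
  rw [segment_eq_image_lineMap]
  rintro _ ⟨s, hs, rfl⟩ ⟨q, hq, hq₁, hq₂⟩
  rw [fst_lineMap] at hq₁
  rw [snd_lineMap, ((hv.mem_chain_iff hn).1 hq).2, hq₁, ((hv.mem_chain_iff hn).1 hg).2] at hq₂
  exact hq₂.not_ge ((h s hs).trans (lineMap_mono_right hp hs.1))

theorem IsXMonotone.visible_of_sees (hv : IsXMonotone v) (hn : 0 < n) (hg : g ∈ chain v)
    (hp : p ∈ chain v) (h : Sees v g p) : Visible (terrain v).height g.1 p.1 := by
  rw [hv.mem_chain_iff hn] at hg hp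
  intro s hs
  by_contra! hlt
  refine disjoint_left.1 h (segment_eq_image_lineMap ℝ g p ▸ mem_image_of_mem _ hs)
    ⟨(lineMap g.1 p.1 s, (terrain v).height (lineMap g.1 p.1 s)), (hv.mem_chain_iff hn).2 ⟨?_, rfl⟩,
      (fst_lineMap ..).symm, ?_⟩
  · exact Convex.lineMap_mem (convex_Icc ..) hg.1 hp.1 hs
  · rwa [snd_lineMap, hg.2, hp.2]

theorem IsXMonotone.guards_iff (hv : IsXMonotone v) (hn : 0 < n) {g : Fin m → ℝ × ℝ}
    (hg : ∀ j, g j ∈ chain v) {H : Finset (Fin m)} :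
    Guards v g H ↔ ∀ x ∈ Icc ((terrain v).X 0) ((terrain v).X (n - 1)),
      ∃ j ∈ H, Visible (terrain v).height (g j).1 x := by
  simp only [Guards, subset_def, mem_iUnion, exists_prop]
  constructor
  · intro h x hx
    have hmem : (x, (terrain v).height x) ∈ chain v := (hv.mem_chain_iff hn).2 ⟨hx, rfl⟩
    obtain ⟨j, hj, hsees⟩ := h _ ⟨_, hmem, rfl, le_rfl⟩
    exact ⟨j, hj, hv.visible_of_sees (p := (x, _)) hn (hg j) hmem hsees⟩
  · rintro h p ⟨q, hq, hq₁, hq₂⟩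
    rw [hv.mem_chain_iff hn, hq₁] at hq
    obtain ⟨j, hj, hvis⟩ := h _ hq.1
    exact ⟨j, hj, hv.sees_of_visible hn (hg j) (hq.2 ▸ hq₂) hvis⟩

end ChainGuard

namespace ChainGuard

open Set AffineMap SignType

/-! ### Finitely many targets -/

theorem exists_div_eq_mod_eq {a b x y : ℕ} (hx : x < a) (hy : y < b) :
    ∃ c < a * b, c / b = x ∧ c % b = y := by
  refine ⟨b * x + y, by nlinarith, ?_, by rw [Nat.mul_add_mod, Nat.mod_eq_of_lt hy]⟩
  rw [Nat.mul_add_div (by lia), Nat.div_eq_of_lt hy, add_zero]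

theorem sign_sub_eq_of_notMem_Ioo {l r p q x : ℝ} (hp : p ∈ Ioo l r) (hq : q ∈ Ioo l r)
    (hx : x ∉ Ioo l r) : sign (p - x) = sign (q - x) := by
  rcases le_or_gt x l with h | h
  · rw [sign_pos (sub_pos.2 (h.trans_lt hp.1)), sign_pos (sub_pos.2 (h.trans_lt hq.1))]
  · have h' : r ≤ x := not_lt.1 fun h' => hx ⟨h, h'⟩
    rw [sign_neg (sub_neg.2 (hp.2.trans_le h')), sign_neg (sub_neg.2 (hq.2.trans_le h'))]

theorem Terrain.isClear_iff_sign {T : Terrain} {a c : ℝ} : T.IsClear a c ↔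
    ∀ i < T.n, sign (T.X i - a) * sign (c - T.X i) = 1 →
      0 ≤ sign (cross T.height a c (T.X i)) * sign (T.X i - a) := by
  refine forall₂_congr fun i _ => ?_
  rw [← sign_mul, sign_eq_one_iff, ← neg_sub (T.X i) c, mul_neg, Left.neg_pos_iff]
  refine imp_congr_right fun h => ?_
  have hsign : sign (c - a) = sign (T.X i - a) := by
    have hpos : 0 < (c - a) * (T.X i - a) := by nlinarith [sq_nonneg (T.X i - a)]
    rcases pos_and_pos_or_neg_and_neg_of_mul_pos hpos with ⟨h₁, h₂⟩ | ⟨h₁, h₂⟩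
    · rw [sign_pos h₁, sign_pos h₂]
    · rw [sign_neg h₁, sign_neg h₂]
  rw [← sign_nonneg_iff, sign_mul, hsign]

theorem exists_gap {s : Finset ℝ} {a b x : ℝ} (ha : a ∈ s) (hb : b ∈ s) (hx : x ∈ Icc a b)
    (hxs : x ∉ s) : ∃ l ∈ s, ∃ r ∈ s, x ∈ Ioo l r ∧ ∀ c ∈ s, c ∉ Ioo l r := by
  have hne : ∀ c ∈ s, c ≠ x := fun c hc h => hxs (h ▸ hc)
  obtain ⟨l, hl, hmax⟩ := {c ∈ s | c < x}.exists_max_image id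
    ⟨a, Finset.mem_filter.2 ⟨ha, hx.1.lt_of_ne (hne a ha)⟩⟩
  obtain ⟨r, hr, hmin⟩ := {c ∈ s | x < c}.exists_min_image id
    ⟨b, Finset.mem_filter.2 ⟨hb, hx.2.lt_of_ne (hne b hb).symm⟩⟩
  simp only [Finset.mem_filter, id_eq] at hl hmax hr hmin
  refine ⟨l, hl.1, r, hr.1, ⟨hl.2, hr.2⟩, fun c hc hmem => ?_⟩
  rcases (hne c hc).lt_or_gt with h | h
  exacts [(hmax c ⟨hc, h⟩).not_gt hmem.1, (hmin c ⟨hc, h⟩).not_gt hmem.2]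

/-- A terrain together with the abscissas of `m` guards on it; `guard j` is irrelevant from
`j = m` on. -/
structure Instance extends Terrain where
  m : ℕ
  guard : ℕ → ℝ

namespace Instance

variable (I : Instance)

/-- The instance comes from an `x`-monotone chain and from guards on it. -/
structure IsValid : Prop where
  n_pos : 0 < I.n
  isMonotone : I.IsMonotone
  guard_mem : ∀ j < I.m, I.guard j ∈ Icc (I.X 0) (I.X (I.n - 1))

/-- The guards in `H` see every point of the chain. -/
def IsGuarded (H : Finset ℕ) : Prop :=
  ∀ x ∈ Icc (I.X 0) (I.X (I.n - 1)), ∃ j ∈ H, I.IsClear (I.guard j) x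

/-- The abscissa of the point of the edge `e` that is collinear with the guard `j` and the vertex
`i`, moved into the range of the chain.  For `i = e` this is the vertex `e`. -/
noncomputable def critical (e j i : ℕ) : ℝ :=
  let h x := cross I.height (I.guard j) x (I.X i)
  max (I.X 0) (min (I.X (I.n - 1))
    (I.X e - h (I.X e) * ((I.X (e + 1) - I.X e) / (h (I.X (e + 1)) - h (I.X e)))))

/-- The critical abscissas in a single sequence. -/
noncomputable def criticalAt (c : ℕ) : ℝ :=
  I.critical (c / I.n / I.m) (c / I.n % I.m) (c % I.n)

/-- The number of critical abscissas. -/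
def numCritical : ℕ := I.n * I.m * I.n

/-- The midpoints between critical abscissas. -/
noncomputable def target (t : ℕ) : ℝ :=
  (I.criticalAt (t / I.numCritical) + I.criticalAt (t % I.numCritical)) / 2

/-- The number of targets. -/
def numTargets : ℕ := I.numCritical * I.numCritical

variable {I} {e i j : ℕ} {l r p q x : ℝ} {H : Finset ℕ}

theorem exists_criticalAt_eq (he : e < I.n) (hj : j < I.m) (hi : i < I.n) :
    ∃ c < I.numCritical, I.criticalAt c = I.critical e j i := by
  obtain ⟨b, hb, rfl, rfl⟩ := exists_div_eq_mod_eq he hj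
  obtain ⟨c, hc, rfl, rfl⟩ := exists_div_eq_mod_eq hb hi
  exact ⟨c, hc, rfl⟩

theorem critical_notMem_Ioo (hgap : ∀ c < I.numCritical, I.criticalAt c ∉ Ioo l r)
    (he : e < I.n) (hj : j < I.m) (hi : i < I.n) : I.critical e j i ∉ Ioo l r := by
  obtain ⟨c, hc, heq⟩ := exists_criticalAt_eq he hj hi
  exact heq ▸ hgap c hc

theorem exists_target_eq {b c : ℕ} (hb : b < I.numCritical) (hc : c < I.numCritical) :
    ∃ t < I.numTargets, I.target t = (I.criticalAt b + I.criticalAt c) / 2 := by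
  obtain ⟨t, ht, rfl, rfl⟩ := exists_div_eq_mod_eq hb hc
  exact ⟨t, ht, rfl⟩

namespace IsValid

variable (hI : I.IsValid)
include hI

theorem critical_mem (e j i : ℕ) : I.critical e j i ∈ Icc (I.X 0) (I.X (I.n - 1)) :=
  ⟨le_max_left _ _, max_le (hI.isMonotone.mem_Icc hI.n_pos).2 (min_le_left _ _)⟩

theorem target_mem (t : ℕ) : I.target t ∈ Icc (I.X 0) (I.X (I.n - 1)) := by
  obtain ⟨h₁, h₂⟩ := hI.critical_mem (t / I.numCritical / I.n / I.m)
    (t / I.numCritical / I.n % I.m) (t / I.numCritical % I.n)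
  obtain ⟨h₃, h₄⟩ := hI.critical_mem (t % I.numCritical / I.n / I.m)
    (t % I.numCritical / I.n % I.m) (t % I.numCritical % I.n)
  constructor <;> simp only [target, criticalAt] <;> linarith

theorem critical_eq_vertex (he : e < I.n) (j : ℕ) : I.critical e j e = I.X e := by
  have hmem := hI.isMonotone.mem_Icc he
  simp [critical, cross, hmem.1, hmem.2]

theorem critical_eq_of_cross_eq (he : e + 1 < I.n) {α β : ℝ}
    (hβ : β ≠ 0) (haff : ∀ x ∈ Icc (I.X e) (I.X (e + 1)),
      cross I.height (I.guard j) x (I.X i) = α + β * x)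
    (hx : x ∈ Icc (I.X e) (I.X (e + 1))) (hx₀ : α + β * x = 0) : I.critical e j i = x := by
  have hlt := hI.isMonotone e.lt_succ_self he
  have hsol : I.X e - (α + β * I.X e) *
      ((I.X (e + 1) - I.X e) / (α + β * I.X (e + 1) - (α + β * I.X e))) = x := by
    rw [add_sub_add_left_eq_sub, ← mul_sub, div_mul_cancel_right₀ (sub_pos.2 hlt).ne',
      eq_neg_of_add_eq_zero_left hx₀]
    field
  have hmem := Icc_subset_Icc (hI.isMonotone.mem_Icc (e.lt_succ_self.trans he)).1
    (hI.isMonotone.mem_Icc he).2 hx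
  simp only [critical]
  rw [haff _ ⟨le_rfl, hlt.le⟩, haff _ ⟨hlt.le, le_rfl⟩, hsol, min_eq_right hmem.2,
    max_eq_right hmem.1]

theorem vertex_notMem_Ioo (hj : j < I.m) (hgap : ∀ c < I.numCritical, I.criticalAt c ∉ Ioo l r)
    (he : e < I.n) : I.X e ∉ Ioo l r :=
  hI.critical_eq_vertex he j ▸ critical_notMem_Ioo hgap he hj he

theorem sign_cross_eq (hj : j < I.m) (hgap : ∀ c < I.numCritical, I.criticalAt c ∉ Ioo l r)
    (he : e + 1 < I.n) (hi : i < I.n) (hl : I.X e ≤ l) (hr : r ≤ I.X (e + 1)) (hp : p ∈ Ioo l r)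
    (hq : q ∈ Ioo l r) :
    sign (cross I.height (I.guard j) p (I.X i)) = sign (cross I.height (I.guard j) q (I.X i)) := by
  have hsub : Ioo l r ⊆ Icc (I.X e) (I.X (e + 1)) :=
    Ioo_subset_Icc_self.trans (Icc_subset_Icc hl hr)
  obtain ⟨α, β, haff⟩ := hI.isMonotone.cross_affine_endpoint he (I.guard j) (I.X i)
  rw [haff p (hsub hp), haff q (hsub hq)]
  rcases eq_or_ne β 0 with rfl | hβ
  · simp
  have hroot : -α / β ∉ Ioo l r := by
    intro hmem
    refine critical_notMem_Ioo hgap (e.lt_succ_self.trans he) hj hi ?_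
    rwa [hI.critical_eq_of_cross_eq he hβ haff (hsub hmem) (by field)]
  have hfactor : ∀ x, α + β * x = β * (x - -α / β) := fun x => by field
  rw [hfactor, hfactor, sign_mul, sign_mul, sign_sub_eq_of_notMem_Ioo hp hq hroot]

theorem isClear_of_isClear (hj : j < I.m)
    (hgap : ∀ c < I.numCritical, I.criticalAt c ∉ Ioo l r) (hl : I.X 0 ≤ l)
    (hr : r ≤ I.X (I.n - 1)) (hp : p ∈ Ioo l r) (hq : q ∈ Ioo l r)
    (h : I.IsClear (I.guard j) p) : I.IsClear (I.guard j) q := by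
  obtain ⟨e, he, hpe⟩ := I.exists_edge ⟨hl.trans_lt hp.1, hp.2.le.trans hr⟩
  have hel : I.X e ≤ l := not_lt.1 fun hle =>
    hI.vertex_notMem_Ioo hj hgap (e.lt_succ_self.trans he) ⟨hle, hpe.1.trans hp.2⟩
  have her : r ≤ I.X (e + 1) := not_lt.1 fun hre =>
    hI.vertex_notMem_Ioo hj hgap he ⟨hp.1.trans_le hpe.2, hre⟩
  rw [Terrain.isClear_iff_sign] at h ⊢
  intro i hi
  rw [sign_sub_eq_of_notMem_Ioo hq hp (hI.vertex_notMem_Ioo hj hgap hi),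
    hI.sign_cross_eq hj hgap he hi hel her hq hp]
  exact h i hi

theorem isGuarded_iff (hH : ∀ j ∈ H, j < I.m) (hm : 0 < I.m) : I.IsGuarded H ↔
    ∀ t < I.numTargets, ∃ j ∈ H, I.IsClear (I.guard j) (I.target t) := by
  refine ⟨fun h t _ => h _ (hI.target_mem t), fun h x hx => ?_⟩
  have hcrit : ∀ e < I.n, ∃ c < I.numCritical, I.criticalAt c = I.X e := fun e he =>
    hI.critical_eq_vertex he 0 ▸ exists_criticalAt_eq he hm he
  set s := (Finset.range I.numCritical).image I.criticalAt with hs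
  have hmem : ∀ y, y ∈ s ↔ ∃ c < I.numCritical, I.criticalAt c = y := by simp [hs]
  by_cases hxs : x ∈ s
  · obtain ⟨c, hc, rfl⟩ := (hmem x).1 hxs
    obtain ⟨t, ht, heq⟩ := exists_target_eq hc hc
    rw [add_self_div_two] at heq
    exact heq ▸ h t ht
  obtain ⟨l, hl, r, hr, hxlr, hgap⟩ := exists_gap ((hmem _).2 (hcrit 0 hI.n_pos))
    ((hmem _).2 (hcrit (I.n - 1) (Nat.sub_one_lt_of_lt hI.n_pos))) hx hxs
  obtain ⟨b, hb, rfl⟩ := (hmem l).1 hl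
  obtain ⟨c, hc, rfl⟩ := (hmem r).1 hr
  obtain ⟨t, ht, heq⟩ := exists_target_eq hb hc
  obtain ⟨j, hj, hclear⟩ := h t ht
  refine ⟨j, hj, hI.isClear_of_isClear (hH j hj) (fun d hd => hgap _ ((hmem _).2 ⟨d, hd, rfl⟩))
    (hI.critical_mem ..).1 (hI.critical_mem ..).2 ?_ hxlr hclear⟩
  rw [heq]
  constructor <;> linarith [hxlr.1, hxlr.2]

end IsValid

end Instance

end ChainGuard

namespace ChainGuard

open Finset RealRAM

/-! ### The selected guards -/

namespace Instance

variable (I : Instance)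

/-- Visibility of the target `t` from the guard `j`. -/
def SeesTarget (j t : ℕ) : Prop :=
  I.IsClear (I.guard j) (I.target t)

/-- The first target of least load under the multiplicative weights after the targets
`p 0, …, p (k - 1)`. -/
noncomputable def lightest (p : ℕ → ℕ) (k : ℕ) : ℕ :=
  firstIndex (fun t => ∀ t' < I.numTargets,
    load I.SeesTarget (range I.m) (weight I.SeesTarget p k) t ≤
      load I.SeesTarget (range I.m) (weight I.SeesTarget p k) t') I.numTargets

/-- The targets that are presented to the multiplicative weights. -/
noncomputable def lightestTargets : List ℕ :=
  history (onList I.lightest) (6 * I.m ^ 2)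

/-- The fractional cover that results from presenting the targets in the list `P`. -/
noncomputable def share (P : List ℕ) : ℕ → ℝ :=
  fractional I.SeesTarget (range I.m) (fun r => P.getD r 0) (6 * I.m ^ 2)

/-- The part of the covering problem in which targets are seen from the side `s` only: from the left
for `s = 1` and from the right for `s = -1`.  Active are the targets that receive at least a third
of their load from that side. -/
noncomputable def cover (P : List ℕ) (s : SignType) : Cover where
  m := I.m
  M := I.numTargets
  Covers j t := SignType.sign (I.target t - I.guard j) = s ∧ I.SeesTarget j t
  IsActive t := load I.SeesTarget (range I.m) (I.share P) t ≤
    3 * load (fun j t => SignType.sign (I.target t - I.guard j) = s ∧ I.SeesTarget j t)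
      (range I.m) (I.share P) t
  guardKey j := s * I.guard j
  targetKey t := s * I.target t

/-- The greedy choices for the side `s`. -/
noncomputable def choices (P : List ℕ) (s : SignType) : List ℕ :=
  history (onList (I.cover P s).choice) I.m

/-- The guards chosen for one of the sides. -/
noncomputable def selection : Finset ℕ :=
  univ.biUnion fun s => (I.cover I.lightestTargets s).chosen fun r =>
    (I.choices I.lightestTargets s).getD r 0

variable {I} {H : Finset ℕ} {P : List ℕ} {s : SignType} {t k : ℕ} {p : ℕ → ℕ}

theorem lightest_congr {p' : ℕ → ℕ} (h : ∀ r < k, p r = p' r) :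
    I.lightest p k = I.lightest p' k := by
  simp only [lightest, weight_congr h]

theorem lightest_spec (ht : t < I.numTargets) : I.lightest p k < I.numTargets ∧
    ∀ t' < I.numTargets, load I.SeesTarget (range I.m) (weight I.SeesTarget p k) (I.lightest p k) ≤
      load I.SeesTarget (range I.m) (weight I.SeesTarget p k) t' := by
  obtain ⟨t₀, ht₀, hmin⟩ := exists_min_image (range I.numTargets)
    (load I.SeesTarget (range I.m) (weight I.SeesTarget p k)) ⟨t, mem_range.2 ht⟩
  simp only [mem_range] at ht₀ hmin
  have hlt : I.lightest p k < I.numTargets := firstIndex_lt ht₀ hmin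
  exact ⟨hlt, firstIndex_spec hlt⟩

theorem share_nonneg (P : List ℕ) (j : ℕ) : 0 ≤ I.share P j :=
  fractional_nonneg ..

theorem sum_load_cover (P : List ℕ) (t : ℕ) :
    ∑ s, load (I.cover P s).Covers (range I.m) (I.share P) t =
      load I.SeesTarget (range I.m) (I.share P) t := by
  classical
  simp only [load, cover]
  rw [sum_comm]
  refine sum_congr rfl fun j _ => ?_
  simp [ite_and]

theorem exists_isActive (P : List ℕ) (t : ℕ) : ∃ s, (I.cover P s).IsActive t := by
  by_contra! hnot
  have : ∀ s, 3 * load (I.cover P s).Covers (range I.m) (I.share P) t <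
      load I.SeesTarget (range I.m) (I.share P) t := fun s => not_le.1 (hnot s)
  have hlt := sum_lt_sum_of_nonempty univ_nonempty fun s _ => this s
  rw [← mul_sum, sum_load_cover] at hlt
  simp [show Fintype.card SignType = 3 from rfl] at hlt

theorem getD_choices (hk : k < I.m) : (I.choices P s).getD k 0 =
    (I.cover P s).choice (fun r => (I.choices P s).getD r 0) k :=
  getD_history_onList Cover.choice_congr hk

theorem mem_selection_lt {j : ℕ} (hj : j ∈ I.selection) : j < I.m := by
  obtain ⟨s, -, hs⟩ := mem_biUnion.1 hj
  exact mem_range.1 (mem_of_mem_filter j hs)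

namespace IsValid

variable (hI : I.IsValid)
include hI

theorem nonempty_of_isGuarded (hH : I.IsGuarded H) : H.Nonempty :=
  let ⟨j, hj, _⟩ := hH _ (hI.isMonotone.mem_Icc hI.n_pos)
  ⟨j, hj⟩

theorem seesTarget_iff_visible {j : ℕ} (hj : j < I.m) (t : ℕ) :
    I.SeesTarget j t ↔ Visible I.height (I.guard j) (I.target t) :=
  (hI.isMonotone.visible_iff_isClear (hI.guard_mem j hj) (hI.target_mem t)).symm

theorem isNested_cover (P : List ℕ) (s : SignType) : (I.cover P s).IsNested := by
  rintro i j t t' hi hj ⟨hjt, hvis⟩ ⟨hjt', hvis'⟩ htt' ⟨hit, hvis''⟩ hij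
  simp only [cover] at hi hj htt' hij ⊢
  rw [hI.seesTarget_iff_visible hj] at hvis hvis'
  rw [hI.seesTarget_iff_visible hi] at hvis'' ⊢
  cases s with
  | zero =>
    rw [SignType.zero_eq_zero, sign_eq_zero_iff, sub_eq_zero] at *
    rw [← hit, hjt, ← hjt']
    exact ⟨rfl, visible_self _ _⟩
  | pos =>
    rw [SignType.pos_eq_one, sign_eq_one_iff, sub_pos] at *
    simp only [SignType.coe_one, one_mul] at htt' hij
    exact ⟨hij.trans_lt hjt', hvis''.of_le_of_le hij hjt htt' hvis'⟩
  | neg =>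
    rw [SignType.neg_eq_neg_one, sign_eq_neg_one_iff, sub_neg] at *
    simp only [SignType.coe_neg_one, neg_mul, one_mul, neg_le_neg_iff] at htt' hij
    rw [visible_comm] at *
    exact ⟨hjt'.trans_le hij, hvis'.of_le_of_le htt' hjt hij hvis''⟩

theorem rounds_le (hG : I.IsGuarded (range I.m)) (hHm : H ⊆ range I.m) (hH : I.IsGuarded H)
    (ht : t < I.numTargets) : (6 * I.m ^ 2 : ℕ) ≤
      2 * #H * load I.SeesTarget (range I.m) (I.share I.lightestTargets) t := by
  refine rounds_le_two_mul_card_mul_load (hI.nonempty_of_isGuarded hG) hHm (by rw [card_range])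
    (fun k _ => hH _ (hI.target_mem _)) fun k hk => ?_
  rw [lightestTargets, getD_history_onList (G := I.lightest) lightest_congr hk]
  exact (lightest_spec ht).2 t ht

theorem m_pos (hG : I.IsGuarded (range I.m)) : 0 < I.m :=
  nonempty_range_iff.1 (hI.nonempty_of_isGuarded hG) |>.bot_lt

theorem card_chosen_le (hG : I.IsGuarded (range I.m)) (hHm : H ⊆ range I.m) (hH : I.IsGuarded H)
    (s : SignType) : #((I.cover I.lightestTargets s).chosen fun r =>
      (I.choices I.lightestTargets s).getD r 0) ≤ 6 * #H := by
  have hm := hI.m_pos hG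
  have hcard : (0 : ℝ) < #H := by exact_mod_cast (hI.nonempty_of_isGuarded hH).card_pos
  have h := (hI.isNested_cover I.lightestTargets s).card_chosen_mul_le
    (fun k hk => getD_choices hk) (share_nonneg I.lightestTargets)
    (θ := (6 * I.m ^ 2 : ℕ) / (6 * #H)) fun t ht hact => by
      rw [div_le_iff₀ (by positivity)]
      calc _ ≤ _ := hI.rounds_le hG hHm hH ht
        _ ≤ _ := mul_le_mul_of_nonneg_left hact (by positivity)
        _ = load (I.cover I.lightestTargets s).Covers (range I.m) (I.share I.lightestTargets) t *
            (6 * #H) := by rw [cover]; ring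
  rw [cover, share, sum_fractional (hI.nonempty_of_isGuarded hG), mul_div_assoc',
    div_le_iff₀ (by positivity), mul_comm] at h
  exact_mod_cast le_of_mul_le_mul_left h (by positivity)

theorem card_selection_le (hG : I.IsGuarded (range I.m)) (hHm : H ⊆ range I.m)
    (hH : I.IsGuarded H) : #I.selection ≤ 18 * #H := by
  calc #I.selection ≤ #(univ : Finset SignType) * (6 * #H) :=
        card_biUnion_le_card_mul _ _ _ fun s _ => hI.card_chosen_le hG hHm hH s
    _ = 18 * #H := by rw [show #(univ : Finset SignType) = 3 from rfl]; ring

theorem exists_covers (hG : I.IsGuarded (range I.m)) (ht : t < I.numTargets)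
    (hact : (I.cover I.lightestTargets s).IsActive t) :
    ∃ j < I.m, (I.cover I.lightestTargets s).Covers j t := by
  have hm := hI.m_pos hG
  have hK : (0 : ℝ) < (6 * I.m ^ 2 : ℕ) := by positivity
  have hload := hI.rounds_le hG Subset.rfl hG ht
  have hpos := pos_of_mul_pos_right (hK.trans_le hload) (by positivity)
  obtain ⟨j, hj, hjt⟩ :=
    exists_of_load_pos (pos_of_mul_pos_right (hpos.trans_le hact) zero_le_three)
  exact ⟨j, mem_range.1 hj, hjt⟩

theorem isGuarded_selection (hG : I.IsGuarded (range I.m)) : I.IsGuarded I.selection := by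
  rw [hI.isGuarded_iff (fun j => mem_selection_lt) (hI.m_pos hG)]
  intro t ht
  obtain ⟨s, hact⟩ := exists_isActive I.lightestTargets t
  obtain ⟨r, hr, hlt, -, hsees⟩ := Cover.exists_covers_of_isActive
    (fun t ht hact => hI.exists_covers hG ht hact) (fun k hk => getD_choices hk) ht hact
  exact ⟨_, mem_biUnion.2 ⟨s, mem_univ s, mem_filter.2 ⟨mem_range.2 hlt, r, hr, rfl⟩⟩, hsees⟩

end IsValid

end Instance

/-! ### Computability of the selection -/

section Load

variable {α : Type} [Layout α] {E : α → ℕ → ℕ → Prop} {k m j t : α → ℕ}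

theorem computes_load {x : α → ℕ → ℝ} (hE : Decides fun z : α × ℕ => E z.1 z.2 (t z.1))
    (hx : Computes fun z : α × ℕ => x z.1 z.2) (hm : IsLimit m) :
    Computes fun a => load (E a) (range (m a)) (x a) (t a) :=
  (hE.ite hx computes_zero).realSum hm

theorem computes_weight {p : α → ℕ → ℕ} (hE : Decides fun z : α × ℕ => E z.1 (j z.1) (p z.1 z.2))
    (hk : IsLimit k) : Computes fun a => weight (E a) (p a) (k a) (j a) := by
  have hfactor := hE.ite (computes_realConst 2) (computes_realConst 1)
  simpa [weight] using hfactor.realProd hk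

end Load

/-- The data of `I a` are kept together with `a`. -/
structure StoresInstance {α : Type} [Layout α] (I : α → Instance) : Prop where
  n : IsLimit fun a => (I a).n
  m : IsLimit fun a => (I a).m
  X : RealArray fun a => (I a).X
  Y : RealArray fun a => (I a).Y
  guard : RealArray fun a => (I a).guard

namespace StoresInstance

variable {α β : Type} [Layout α] [Slot β] {I : α → Instance} {e i j k t : α → ℕ} {x y z : α → ℝ}
  {l q : α → List ℕ}

theorem weaken (hI : StoresInstance I) : StoresInstance fun z : α × β => I z.1 :=
  ⟨hI.n.weaken, hI.m.weaken, hI.X.weaken, hI.Y.weaken, hI.guard.weaken⟩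

theorem computes_height (hI : StoresInstance I) (hx : Computes x) :
    Computes fun a => (I a).height (x a) := by
  have hI' : StoresInstance fun z : α × ℕ => I z.1 := hI.weaken
  have he : Computes fun z : α × ℕ => z.2 + 1 := computes_snd.natAdd (computes_natConst 1)
  have hX := hI'.X.computes computes_snd
  have hX' := hI'.X.computes he
  have hslope := ((hI'.Y.computes he).realSub (hI'.Y.computes computes_snd)).realDiv
    (hX'.realSub hX)
  have hlength := (hX.realMax (hx.weaken.realMin hX')).realSub hX
  exact (hI.Y.computes (computes_natConst 0)).realAdd
    ((hslope.realMul hlength).realSum (hI.n.sub (isLimit_const 1)))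

theorem computes_cross (hI : StoresInstance I) (hx : Computes x) (hy : Computes y)
    (hz : Computes z) : Computes fun a => cross (I a).height (x a) (y a) (z a) := by
  have hheight := hI.computes_height hx
  exact (((hI.computes_height hy).realSub hheight).realMul (hz.realSub hx)).realSub
    (((hI.computes_height hz).realSub hheight).realMul (hy.realSub hx))

theorem decides_isClear (hI : StoresInstance I) (hx : Computes x) (hy : Computes y) :
    Decides fun a => (I a).IsClear (x a) (y a) := by
  have hX := (hI.weaken (β := ℕ)).X.computes computes_snd
  have hbetween := decides_realLt ((hX.realSub hx.weaken).realMul (hX.realSub hy.weaken))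
    computes_zero
  have hbelow := decides_realLe computes_zero
    ((hI.weaken.computes_cross hx.weaken hy.weaken hX).realMul (hy.weaken.realSub hx.weaken))
  exact (hbetween.imp hbelow).forall_lt hI.n

theorem computes_critical (hI : StoresInstance I) (he : Computes e) (hj : Computes j)
    (hi : Computes i) : Computes fun a => (I a).critical (e a) (j a) (i a) := by
  have hX := hI.X.computes he
  have hX' := hI.X.computes (he.natAdd (computes_natConst 1))
  have hguard := hI.guard.computes hj
  have hvertex := hI.X.computes hi
  have hcross := hI.computes_cross hguard hX hvertex
  have hcross' := hI.computes_cross hguard hX' hvertex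
  exact (hI.X.computes (computes_natConst 0)).realMax
    ((hI.X.computes (hI.n.computes.natSub (computes_natConst 1))).realMin
      (hX.realSub (hcross.realMul ((hX'.realSub hX).realDiv (hcross'.realSub hcross)))))

theorem computes_criticalAt (hI : StoresInstance I) (ht : IsLimit t) :
    Computes fun a => (I a).criticalAt (t a) :=
  hI.computes_critical ((ht.div hI.n).div hI.m).computes ((ht.div hI.n).mod hI.m).computes
    (ht.mod hI.n).computes

theorem isLimit_numCritical (hI : StoresInstance I) : IsLimit fun a => (I a).numCritical :=
  (hI.n.mul hI.m).mul hI.n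

theorem isLimit_numTargets (hI : StoresInstance I) : IsLimit fun a => (I a).numTargets :=
  hI.isLimit_numCritical.mul hI.isLimit_numCritical

theorem computes_target (hI : StoresInstance I) (ht : IsLimit t) :
    Computes fun a => (I a).target (t a) := by
  have hnum := hI.isLimit_numCritical
  simpa [Instance.target] using ((hI.computes_criticalAt (ht.div hnum)).realAdd
    (hI.computes_criticalAt (ht.mod hnum))).realDiv (computes_realConst 2)

theorem decides_seesTarget (hI : StoresInstance I) (hj : Computes j) (ht : IsLimit t) :
    Decides fun a => (I a).SeesTarget (j a) (t a) :=
  hI.decides_isClear (hI.guard.computes hj) (hI.computes_target ht)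

theorem computes_weight (hI : StoresInstance I) (hl : IsStored l) (hk : IsLimit k)
    (hj : Computes j) :
    Computes fun a => weight (I a).SeesTarget (fun r => (l a).getD r 0) (k a) (j a) :=
  ChainGuard.computes_weight
    (hI.weaken.decides_seesTarget hj.weaken (hl.weaken.isLimit_getD computes_snd)) hk

theorem computes_load_weight (hI : StoresInstance I) (hl : IsStored l) (ht : IsLimit t) :
    Computes fun a => load (I a).SeesTarget (range (I a).m)
      (weight (I a).SeesTarget (fun r => (l a).getD r 0) (l a).length) (t a) :=
  computes_load (hI.weaken.decides_seesTarget computes_snd ht.weaken)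
    (hI.weaken.computes_weight hl.weaken hl.weaken.isLimit_length computes_snd) hI.m

theorem isLimit_lightest (hI : StoresInstance I) (hl : IsStored l) :
    IsLimit fun a => onList (I a).lightest (l a) := by
  refine Decides.isLimit_firstIndex ?_ hI.isLimit_numTargets
  have hI' : StoresInstance fun z : α × ℕ => I z.1 := hI.weaken
  have hl' : IsStored fun z : α × ℕ => l z.1 := hl.weaken
  have hleast := decides_realLe
    (hI'.weaken.weaken.computes_load_weight hl'.weaken.weaken isLimit_snd.weaken)
    (hI'.weaken.weaken.computes_load_weight hl'.weaken.weaken isLimit_snd)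
  exact hleast.forall_lt hI'.weaken.isLimit_numTargets

theorem isLimit_rounds (hI : StoresInstance I) : IsLimit fun a => 6 * (I a).m ^ 2 := by
  simpa only [pow_two] using (isLimit_const 6).mul (hI.m.mul hI.m)

theorem computes_share (hI : StoresInstance I) (hl : IsStored l) (hj : Computes j) :
    Computes fun a => (I a).share (l a) (j a) := by
  have hweight := hI.weaken.computes_weight hl.weaken isLimit_snd hj.weaken
  have htotal := (hI.weaken.weaken.computes_weight hl.weaken.weaken isLimit_snd.weaken
    computes_snd).realSum hI.weaken.m
  exact (hweight.realDiv htotal).realSum hI.isLimit_rounds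

section Cover

variable (s : SignType)

theorem decides_covers (hI : StoresInstance I) (l : α → List ℕ) (hj : Computes j)
    (ht : IsLimit t) : Decides fun a => ((I a).cover (l a) s).Covers (j a) (t a) :=
  (decides_sign_eq ((hI.computes_target ht).realSub (hI.guard.computes hj)) s).and
    (hI.decides_seesTarget hj ht)

theorem decides_isActive (hI : StoresInstance I) (hl : IsStored l) (ht : IsLimit t) :
    Decides fun a => ((I a).cover (l a) s).IsActive (t a) := by
  have hshare := hI.weaken.computes_share hl.weaken computes_snd
  have hload := computes_load (E := fun a => (I a).SeesTarget) (x := fun a => (I a).share (l a))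
    (hI.weaken.decides_seesTarget computes_snd ht.weaken) hshare hI.m
  have hpart := computes_load (E := fun a => ((I a).cover (l a) s).Covers)
    (x := fun a => (I a).share (l a))
    (hI.weaken.decides_covers s (fun z => l z.1) computes_snd ht.weaken) hshare hI.m
  simpa [Instance.cover] using decides_realLe hload ((computes_realConst 3).realMul hpart)

theorem decides_isOpen (hI : StoresInstance I) (hl : IsStored l) (hq : IsStored q)
    (ht : IsLimit t) : Decides fun a =>
      ((I a).cover (l a) s).IsOpen (fun r => (q a).getD r 0) (q a).length (t a) := by
  have hcovers := hI.weaken.decides_covers s (fun z => l z.1)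
    (hq.weaken.isLimit_getD computes_snd).computes ht.weaken
  exact (hI.decides_isActive s hl ht).and (hcovers.not.forall_lt hq.isLimit_length)

theorem computes_sign_mul (hx : Computes x) : Computes fun a => (s : ℝ) * x a := by
  cases s with
  | zero => simpa using computes_zero
  | neg => simpa using (computes_realConst (-1)).realMul hx
  | pos => simpa using hx

theorem decides_isChoice (hI : StoresInstance I) (hl : IsStored l) (hq : IsStored q)
    (ht : IsLimit t) (hj : Computes j) : Decides fun a =>
      ((I a).cover (l a) s).IsChoice (fun r => (q a).getD r 0) (q a).length (t a) (j a) := by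
  have hkey := computes_sign_mul s (hI.computes_target ht)
  have hkey' := computes_sign_mul s (hI.guard.computes hj)
  have hleast := ((hI.weaken.decides_isOpen s hl.weaken hq.weaken isLimit_snd).imp
    (decides_realLe hkey.weaken (computes_sign_mul s (hI.weaken.computes_target isLimit_snd)))
    ).forall_lt hI.isLimit_numTargets
  have hleast' := ((hI.weaken.decides_covers s (fun z => l z.1) computes_snd ht.weaken).imp
    (decides_realLe hkey'.weaken (computes_sign_mul s (hI.weaken.guard.computes computes_snd)))
    ).forall_lt hI.m
  exact ((hI.decides_isOpen s hl hq ht).and (hleast.and ((hI.decides_covers s l hj ht).and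
    hleast'))).congr fun a => Cover.isChoice_iff

theorem isLimit_choice (hI : StoresInstance I) (hl : IsStored l) (hq : IsStored q) :
    IsLimit fun a => onList ((I a).cover (l a) s).choice (q a) := by
  refine Decides.isLimit_firstIndex ?_ hI.m
  have hI' : StoresInstance fun z : (α × ℕ) × ℕ => I z.1.1 := hI.weaken.weaken
  have hl' : IsStored fun z : (α × ℕ) × ℕ => l z.1.1 := hl.weaken.weaken
  have hq' : IsStored fun z : (α × ℕ) × ℕ => q z.1.1 := hq.weaken.weaken
  exact (hI'.weaken.decides_isChoice s hl'.weaken hq'.weaken isLimit_snd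
    computes_snd.weaken).exists_lt hI'.isLimit_numTargets

theorem constructs_choices (hI : StoresInstance I) (hl : IsStored l) :
    Constructs fun a => (I a).choices (l a) s :=
  (hI.weaken.isLimit_choice s hl.weaken isStored_snd).computes.constructs_history hI.m
    hI.m.polyBounded fun _ _ => firstIndex_le _ _

end Cover

theorem constructs_lightestTargets (hI : StoresInstance I) :
    Constructs fun a => (I a).lightestTargets :=
  (hI.weaken.isLimit_lightest isStored_snd).computes.constructs_history hI.isLimit_rounds
    hI.isLimit_numTargets.polyBounded fun _ _ => firstIndex_le _ _

end StoresInstance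

/-- The numbers `n` and `m` are held by the variables `0` and `1`; the real arrays `0`, `1` and `2`
hold the coordinates of the vertices and the abscissas of the guards. -/
instance : Layout Instance where
  width := 2
  width_pos := two_pos
  size I := I.n + I.m
  Holds I s := s.natVar 0 = I.n ∧ s.natVar 1 = I.m ∧ s.realArr 0 = I.X ∧ s.realArr 1 = I.Y ∧
    s.realArr 2 = I.guard
  holds_of_agree h := by
    rw [h.realArr, h.natVar 0 two_pos, h.natVar 1 one_lt_two]
    exact id
  holds_setNatArr_zero h _ _ := h

theorem storesInstance_id : StoresInstance fun I : Instance => I where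
  n := ⟨computes_natVar two_pos fun _ _ hs => hs.1, .X, fun I => by simp [Layout.size]⟩
  m := ⟨computes_natVar one_lt_two fun _ _ hs => hs.2.1, .X, fun I => by simp [Layout.size]⟩
  X := ⟨0, fun _ _ hs => hs.2.2.1⟩
  Y := ⟨1, fun _ _ hs => hs.2.2.2.1⟩
  guard := ⟨2, fun _ _ hs => hs.2.2.2.2⟩

theorem exists_sign_iff {p : SignType → Prop} : (∃ s, p s) ↔ p 0 ∨ p 1 ∨ p (-1) := by
  refine ⟨fun ⟨s, h⟩ => ?_, fun h => h.elim (⟨_, ·⟩) (·.elim (⟨_, ·⟩) (⟨_, ·⟩))⟩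
  cases s
  exacts [.inl h, .inr (.inr h), .inr (.inl h)]

namespace Instance

theorem mem_selection_iff {I : Instance} {j : ℕ} : j ∈ I.selection ↔
    j < I.m ∧ ∃ s, ∃ r < I.m, (I.choices I.lightestTargets s).getD r 0 = j := by
  simp [selection, Cover.chosen, cover]

theorem marks_selection : Marks (fun x : Instance × ℕ => x.2 ∈ x.1.selection) Instance.m := by
  have hI : StoresInstance fun x : Instance × List ℕ => x.1 := storesInstance_id.weaken
  have hI₀ : StoresInstance fun x : (Instance × List ℕ) × List ℕ => x.1.1 := hI.weaken
  have hI₁ : StoresInstance fun x : ((Instance × List ℕ) × List ℕ) × List ℕ => x.1.1.1 :=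
    hI₀.weaken
  have hI₂ : StoresInstance fun x : (((Instance × List ℕ) × List ℕ) × List ℕ) × List ℕ =>
    x.1.1.1.1 := hI₁.weaken
  have hlightest := storesInstance_id.constructs_lightestTargets
  have hzero := hI.constructs_choices 0 isStored_snd
  have hpos := hI₀.constructs_choices 1 isStored_snd.weaken
  have hneg := hI₁.constructs_choices (-1) isStored_snd.weaken.weaken
  have hchosen {l} (hl : IsStored l) :=
    (decides_natEq (hl.weaken.weaken.isLimit_getD computes_snd).computes
      computes_snd.weaken).exists_lt hI₂.weaken.m
  have hmem := (hchosen isStored_snd.weaken.weaken).or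
    ((hchosen isStored_snd.weaken).or (hchosen isStored_snd))
  obtain ⟨P, τ, hτ, hP⟩ := hlightest.marks (hzero.marks (hpos.marks (hneg.marks
    (hmem.marks hI₂.m))))
  refine ⟨P, τ, hτ, fun I s hs => (hP I s hs).mono le_rfl fun s' hs' j hj => ?_⟩
  exact (hs' j hj).trans
    (mem_selection_iff.trans ((and_iff_right hj).trans exists_sign_iff)).symm

end Instance

/-! ### Instances from chains -/

section ChainInstance

variable {n m : ℕ} {v : Fin n → ℝ × ℝ} {g : Fin m → ℝ × ℝ} {H : Finset (Fin m)}

variable (v g) in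
/-- The instance given by the chain with vertices `v` and the guards `g`. -/
def chainInstance : Instance where
  toTerrain := terrain v
  m := m
  guard := extend fun j => (g j).1

theorem guard_chainInstance (j : Fin m) : (chainInstance v g).guard j = (g j).1 :=
  extend_apply (fun j => (g j).1) j

theorem holds_input (v : Fin n → ℝ × ℝ) (g : Fin m → ℝ × ℝ) :
    Layout.Holds (chainInstance v g) (input v g) :=
  ⟨rfl, rfl, rfl, rfl, rfl⟩

theorem pos_of_mem_chain {p : ℝ × ℝ} (hp : p ∈ chain v) : 0 < n := by
  rcases hp with ⟨i, _⟩ | ⟨i, _⟩ <;> exact i.pos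

theorem IsXMonotone.isValid (hv : IsXMonotone v) (hn : 0 < n) (hg : ∀ j, g j ∈ chain v) :
    (chainInstance v g).IsValid where
  n_pos := hn
  isMonotone := hv.isMonotone
  guard_mem j hj := by
    exact guard_chainInstance (v := v) (g := g) ⟨j, hj⟩ ▸ ((hv.mem_chain_iff hn).1 (hg _)).1

theorem IsXMonotone.guards_iff_isGuarded (hv : IsXMonotone v) (hn : 0 < n)
    (hg : ∀ j, g j ∈ chain v) :
    Guards v g H ↔ (chainInstance v g).IsGuarded (H.map Fin.valEmbedding) := by
  rw [hv.guards_iff hn hg]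
  refine forall₂_congr fun x hx => ?_
  simp only [mem_map, exists_exists_and_eq_and, Fin.valEmbedding_apply, guard_chainInstance]
  exact exists_congr fun j => and_congr_right fun _ =>
    hv.isMonotone.visible_iff_isClear ((hv.mem_chain_iff hn).1 (hg j)).1 hx

theorem map_output {s : State} {S : Finset ℕ} (hS : ∀ j ∈ S, j < m)
    (hs : ∀ j < m, s.natArr 0 j = 1 ↔ j ∈ S) : (output m s).map Fin.valEmbedding = S := by
  ext j
  simp only [output, mem_map, mem_filter_univ, Fin.valEmbedding_apply]
  refine ⟨?_, fun hj => ⟨⟨j, hS j hj⟩, (hs j (hS j hj)).2 hj, rfl⟩⟩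
  rintro ⟨i, hi, rfl⟩
  exact (hs i i.2).1 hi

end ChainInstance

end ChainGuard

theorem mainTheorem3 :
    ∃ (A : RealRAM.Prog) (K : ℕ) (T : Polynomial ℕ),
      ∀ (n m : ℕ) (v : Fin n → ℝ × ℝ) (g : Fin m → ℝ × ℝ),
        ChainGuard.IsXMonotone v →
        (∀ j, g j ∈ ChainGuard.chain v) →
        ChainGuard.Guards v g Finset.univ →
        ∃ (s : RealRAM.State) (t : ℕ),
          RealRAM.Exec A (ChainGuard.input v g) s t ∧
          t ≤ T.eval (n + m) ∧
          ChainGuard.Guards v g (ChainGuard.output m s) ∧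
          ∀ H : Finset (Fin m), ChainGuard.Guards v g H →
            (ChainGuard.output m s).card ≤ K * H.card := by
  obtain ⟨A, τ, ⟨T, hT⟩, hA⟩ := ChainGuard.Instance.marks_selection
  refine ⟨A, 18, T, fun n m v g hv hg hG => ?_⟩
  obtain ⟨s, t, hs, ht, hmarks⟩ := hA _ _ (ChainGuard.holds_input v g)
  refine ⟨s, t, hs, ht.trans (hT _), ?_⟩
  rcases m.eq_zero_or_pos with rfl | hm
  · rw [Finset.eq_empty_of_isEmpty (ChainGuard.output 0 s)]
    exact ⟨Finset.eq_empty_of_isEmpty (Finset.univ : Finset (Fin 0)) ▸ hG, fun H _ => Nat.zero_le _⟩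
  have hn := ChainGuard.pos_of_mem_chain (hg ⟨0, hm⟩)
  have hI := hv.isValid hn hg
  have huniv : Finset.univ.map Fin.valEmbedding = Finset.range m :=
    Fin.map_valEmbedding_univ.trans (Nat.Iio_eq_range m)
  have hmap : (ChainGuard.output m s).map Fin.valEmbedding =
      (ChainGuard.chainInstance v g).selection :=
    ChainGuard.map_output (fun _ => ChainGuard.Instance.mem_selection_lt) hmarks
  simp only [hv.guards_iff_isGuarded hn hg, huniv] at hG ⊢
  rw [← Finset.card_map Fin.valEmbedding, hmap]
  refine ⟨hI.isGuarded_selection hG, fun H hH => ?_⟩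
  rw [← H.card_map Fin.valEmbedding]
  exact hI.card_selection_le hG (huniv ▸ Finset.map_subset_map.2 H.subset_univ) hH
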